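/- Let $d\ge 1$, $\beta\ge 0$, $\sigma>0$ and put $x=\beta\sigma$. For a finite $\Lambda\subset\mathbb Z^d$ let $B(\Lambda)$ be the set of nearest-neighbour bonds $b=(n,n')$ with $n,n'\in\Lambda$ (free boundary conditions), and for Ising spins $S\in\{-1,1\}^\Lambda$ write $S_b=S_nS_{n'}$. Given numbers $x_b\ge 0$, consider the Gaussian Edwards–Anderson model on the Nishimori line: the couplings $J_b$, $b\in B(\Lambda)$, are independent Gaussians with mean $\sigma x_b$ and variance $\sigma^2$, the local inverse temperatures are $\beta_b=x_b/\sigma$, and $U=\sum_{b\in B(\Lambda)}\beta_bJ_bS_b$. Let $[\,\cdot\,]$ be the average over the $J_b$, let $\langle f\rangle=\sum_S f(S)e^U/\sum_S e^U$, and let $P_\Lambda=\big[\ln\sum_S e^{U}\big]$ when $x_b=x$ for all $b$. For $L\ge1$ let $\Lambda_{2L}=\{1,\dots,2L\}^d$, divided into its $2^d$ cubes $\Lambda^{(i)}_{L}$ of side $L$. The adjacency pressure is $T_L=P_{\Lambda_{2L}}-\sum_{i=1}^{2^d}P_{\Lambda^{(i)}_L}$, and the corridor $\mathcal C_L$ is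 the set of bonds of $\Lambda_{2L}$ that join two different cubes. For $t\in[0,1]$ let $[\langle\,\cdot\,\rangle_t]_t$ be the quenched expectation on $\Lambda_{2L}$ for $x_b=x\sqrt t$ if $b\in\mathcal C_L$ and $x_b=x$ otherwise. Then there is a function $c:[0,1]\to\mathbb R$, integrable on $[0,1]$, such that: 1. for every $t\in[0,1]$, $c(t)$ is the limit of $[\langle S_1S_2\rangle_t]_t$ for nearest neighbours $S_1,S_2$ of two adjacent cubes far away from the outer boundary of these cubes: for every $\varepsilon>0$ there is an $R$ such that for all $L$ and every bond $(n_1,n_2)\in\mathcal C_L$, with $n_2=n_1+e_i$ for a standard unit vector $e_i$, for which every site of $\mathbb Z^d$ within sup-distance $R$ of $n_1$ belongs to the union of the two cubes joined by the bond, $\big|[\langle S_{n_1}S_{n_2}\rangle_t]_t-c(t)\big|<\varepsilon$; 2. the limit of $T_L/L^{d-1}$ exists and $$\lim_{L\to\infty}\frac{T_L}{L^{d-1}}=d\,x^2\,2^{d-2}\Big(1+\int_0^1c(t)\,dt\Big);$$ 3. if $\beta>0$, this limit is strictly positive, so that $T_L$ grows in proportion to $L^{d-1}$. -/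

import Mathlib

open MeasureTheory ProbabilityTheory Filter Topology

namespace EA

/-- Sites of the lattice `ℤ^d`. -/
abbrev Site (d : ℕ) := Fin d → ℤ

/-- Nearest-neighbour bonds of `ℤ^d`: the pair `(n, i)` stands for the unordered bond
`{n, n + e_i}`, so that every bond occurs exactly once. -/
abbrev Bond (d : ℕ) := Site d × Fin d

/-- The first endpoint `n` of the bond `{n, n + e_i}`. -/
def Bond.src {d : ℕ} (b : Bond d) : Site d := b.1

/-- The second endpoint `n + e_i` of the bond `{n, n + e_i}`. -/
def Bond.tgt {d : ℕ} (b : Bond d) : Site d := b.1 + Pi.single b.2 1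

/-- `B(Λ)`: the bonds with both endpoints in `Λ` (free boundary conditions). -/
def bonds {d : ℕ} (Λ : Finset (Site d)) : Finset (Bond d) :=
  (Λ ×ˢ Finset.univ).filter fun b => Bond.tgt b ∈ Λ

theorem src_mem {d : ℕ} {Λ : Finset (Site d)} (b : bonds Λ) : Bond.src b.1 ∈ Λ :=
  (Finset.mem_product.1 (Finset.mem_filter.1 b.2).1).1

theorem tgt_mem {d : ℕ} {Λ : Finset (Site d)} (b : bonds Λ) : Bond.tgt b.1 ∈ Λ :=
  (Finset.mem_filter.1 b.2).2

/-- Configurations of Ising spins on `Λ`; `ℤˣ = {1, -1}`. -/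
abbrev Config {d : ℕ} (Λ : Finset (Site d)) := Λ → ℤˣ

/-- `S_b = S_n S_{n'}` for a bond `b = (n, n')`. -/
def bondSpin {d : ℕ} {Λ : Finset (Site d)} (b : bonds Λ) (S : Config Λ) : ℝ :=
  ((S ⟨Bond.src b.1, src_mem b⟩ * S ⟨Bond.tgt b.1, tgt_mem b⟩ : ℤˣ) : ℤ)

/-- The potential `U = ∑_{b ∈ B(Λ)} β_b J_b S_b`. -/
def potential {d : ℕ} (Λ : Finset (Site d)) (β : Bond d → ℝ) (J : bonds Λ → ℝ)
    (S : Config Λ) : ℝ :=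
  ∑ b : bonds Λ, β b.1 * J b * bondSpin b S

/-- The partition function `∑_{S} e^U`. -/
noncomputable def partitionFn {d : ℕ} (Λ : Finset (Site d)) (β : Bond d → ℝ)
    (J : bonds Λ → ℝ) : ℝ :=
  ∑ S : Config Λ, Real.exp (potential Λ β J S)

/-- The Boltzmann-Gibbs expectation `⟨f⟩` at fixed disorder `J`. -/
noncomputable def gibbs {d : ℕ} (Λ : Finset (Site d)) (β : Bond d → ℝ)
    (J : bonds Λ → ℝ) (f : Config Λ → ℝ) : ℝ :=
  (∑ S : Config Λ, f S * Real.exp (potential Λ β J S)) / partitionFn Λ β J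

/-- The law of the disorder: independent Gaussians `J_b` of mean `μ_b` and variance `σ_b²`. -/
noncomputable def disorder {d : ℕ} (Λ : Finset (Site d)) (μ σ : Bond d → ℝ) :
    Measure (bonds Λ → ℝ) :=
  Measure.pi fun b : bonds Λ => gaussianReal (μ b.1) ⟨σ b.1 ^ 2, sq_nonneg _⟩

/-- The quenched pressure `P = [ln ∑_{S} e^U]`. -/
noncomputable def pressure {d : ℕ} (Λ : Finset (Site d)) (β μ σ : Bond d → ℝ) : ℝ :=
  ∫ J, Real.log (partitionFn Λ β J) ∂(disorder Λ μ σ)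

/-- The quenched bond correlation `[⟨S_b⟩]`. -/
noncomputable def bondCorr {d : ℕ} (Λ : Finset (Site d)) (β μ σ : Bond d → ℝ)
    (b : bonds Λ) : ℝ :=
  ∫ J, gibbs Λ β J (bondSpin b) ∂(disorder Λ μ σ)

/-- The pressure on the (generalized) Nishimori line `β_b = x_b / σ_b`, `μ_b = σ_b x_b`. -/
noncomputable def nlPressure {d : ℕ} (Λ : Finset (Site d)) (σ x : Bond d → ℝ) : ℝ :=
  pressure Λ (fun b => x b / σ b) (fun b => σ b * x b) σ

/-- The quenched bond correlation on the (generalized) Nishimori line. -/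
noncomputable def nlBondCorr {d : ℕ} (Λ : Finset (Site d)) (σ x : Bond d → ℝ)
    (b : bonds Λ) : ℝ :=
  bondCorr Λ (fun b => x b / σ b) (fun b => σ b * x b) σ b

/-- The cube `∏_i {a_i + 1, …, a_i + ℓ}` of side `ℓ`. -/
noncomputable def cube {d : ℕ} (a : Site d) (ℓ : ℕ) : Finset (Site d) :=
  Fintype.piFinset fun i => Finset.Icc (a i + 1) (a i + ℓ)

/-- The box `{1, …, 2L}^d` of side `2L`. -/
noncomputable def bigBox (d L : ℕ) : Finset (Site d) := cube 0 (2 * L)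

/-- The `2^d` sub-boxes of side `L` composing the box of side `2L`, indexed by `{0,1}^d`. -/
noncomputable def subBox {d : ℕ} (L : ℕ) (s : Fin d → Fin 2) : Finset (Site d) :=
  cube (fun i => (L : ℤ) * ((s i : ℕ) : ℤ)) L

/-- The corridor: the bonds of the box of side `2L` that join two different sub-boxes. -/
noncomputable def corridor (d L : ℕ) : Finset (Bond d) :=
  (bonds (bigBox d L)).filter fun b =>
    ∃ s s' : Fin d → Fin 2, s ≠ s' ∧ Bond.src b ∈ subBox L s ∧ Bond.tgt b ∈ subBox L s'

/-- The adjacency pressure `T_L` on the Nishimori line, at uniform inverse temperature `β`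
and standard deviation `σ`, that is with `x_b = βσ` for every bond. -/
noncomputable def adjacencyPressure (d : ℕ) (β σ : ℝ) (L : ℕ) : ℝ :=
  nlPressure (bigBox d L) (fun _ => σ) (fun _ => β * σ)
    - ∑ s : Fin d → Fin 2, nlPressure (subBox L s) (fun _ => σ) (fun _ => β * σ)

/-- The interpolation scheme: `x_b = x √t` on the corridor and `x_b = x` elsewhere. -/
noncomputable def cutParam (d L : ℕ) (x t : ℝ) (b : Bond d) : ℝ :=
  if b ∈ corridor d L then x * Real.sqrt t else x

/-- The bond `b` joins two adjacent sub-boxes and lies at distance more than `R` from the outer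
boundary of these two boxes: every site within sup-distance `R` of its first endpoint belongs
to their union. -/
def FarCorridorBond {d : ℕ} (L R : ℕ) (b : Bond d) : Prop :=
  ∃ s s' : Fin d → Fin 2, s ≠ s' ∧ Bond.src b ∈ subBox L s ∧ Bond.tgt b ∈ subBox L s' ∧
    ∀ m : Site d, (∀ j, |m j - Bond.src b j| ≤ (R : ℤ)) → m ∈ subBox L s ∪ subBox L s'

end EA

/-! In the variables `y_b = β_b J_b` the Nishimori line says that mean and variance coincide, both
being `x_b²`. Such a Gaussian has density proportional to `e^{y_b}` relative to the centred one, and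
averaging over gauge transformations turns the product of these densities into the partition
function `Z`. Up to normalisation `[⟨S_b⟩]` is then the centred average of `A²/Z`, where `A` is the
unnormalised sum of `S_b`. This gives Nishimori's identity `[⟨S_b⟩] = [⟨S_b⟩²]` (`corr_eq_sq`). It
also gives monotonicity in every `x_b ≥ 0` (`corr_mono`): `A²/Z` is convex in `(A, Z)`, and extra
independent noise multiplies the means of `A` and `Z` by one common factor. Monotonicity in the
volume follows, since a missing bond is a bond with `x_b = 0` (`corr_le_corr`).

Gaussian integration by parts and Nishimori's identity give `∂P/∂x_b = x_b (1 + [⟨S_b⟩])`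
(`hasDerivAt_press`). The parameters `x√t` on the corridor lead from decoupled cubes to the full
box, so `T_L` is `x²/2` times the integral over `t` of the corridor sum of `1 + [⟨S_b⟩_t]_t`
(`adjacencyPressure_eq_integral`).

The function `c` is `interfaceCorr`, the supremum over centred boxes of the correlation across a
plane of modified bonds. By monotonicity every corridor correlation is at most `c(t)`
(`nlBondCorr_le_interfaceCorr`), and one far from the outer boundary is at least its value in a
finite centred box (`planeCorr_le_nlBondCorr`). For fixed distance, all but a vanishing fraction of
the `d (2L)^(d-1)` corridor bonds are far, so the normalised corridor sum converges for each `t`,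
and dominated convergence gives the limit. It is positive because `c ≥ 0`, again by Nishimori's
identity. -/

set_option linter.unusedSectionVars false

namespace EA

open scoped NNReal ENNReal

/-! ### Finite Ising systems whose bond spins are characters of a group of configurations. -/

section SpinSystem

variable {E G : Type*} [Fintype E] [Fintype G] [CommGroup G]

/-- The real value `±1` of the character `s b` at the configuration `S`. -/
def sgn (s : E → G →* ℤˣ) (b : E) (S : G) : ℝ := ((s b S : ℤˣ) : ℤ)

/-- The Boltzmann weight `exp (∑_b y_b S_b)`. -/
noncomputable def weight (s : E → G →* ℤˣ) (y : E → ℝ) (S : G) : ℝ :=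
  Real.exp (∑ b, y b * sgn s b S)

/-- The partition function `∑_S exp (∑_b y_b S_b)`. -/
noncomputable def partSum (s : E → G →* ℤˣ) (y : E → ℝ) : ℝ := ∑ S, weight s y S

/-- The unnormalized average of `S_b`. -/
noncomputable def spinSum (s : E → G →* ℤˣ) (b : E) (y : E → ℝ) : ℝ :=
  ∑ S, sgn s b S * weight s y S

/-- The Gibbs average of `S_b`. -/
noncomputable def spinMean (s : E → G →* ℤˣ) (b : E) (y : E → ℝ) : ℝ :=
  spinSum s b y / partSum s y

/-- Independent centred Gaussians of variances `v`. -/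
noncomputable def noise (v : E → ℝ≥0) : Measure (E → ℝ) := Measure.pi fun b => gaussianReal 0 (v b)

/-- Independent Gaussians of means and variances `v`: the Nishimori line. -/
noncomputable def signal (v : E → ℝ≥0) : Measure (E → ℝ) :=
  Measure.pi fun b => gaussianReal (v b) (v b)

/-- The quenched correlation on the Nishimori line. -/
noncomputable def corr (s : E → G →* ℤˣ) (v : E → ℝ≥0) (b : E) : ℝ :=
  ∫ y, spinMean s b y ∂(signal v)

/-- The quenched pressure on the Nishimori line. -/
noncomputable def press (s : E → G →* ℤˣ) (v : E → ℝ≥0) : ℝ :=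
  ∫ y, Real.log (partSum s y) ∂(signal v)

instance (v : E → ℝ≥0) : IsProbabilityMeasure (noise v) := by unfold noise; infer_instance
instance (v : E → ℝ≥0) : IsProbabilityMeasure (signal v) := by unfold signal; infer_instance

variable (s : E → G →* ℤˣ)

theorem sgn_eq_or (b : E) (S : G) : sgn s b S = 1 ∨ sgn s b S = -1 := by
  rcases Int.units_eq_one_or (s b S) with h | h <;> simp [sgn, h]

theorem sgn_mul_self (b : E) (S : G) : sgn s b S * sgn s b S = 1 := by
  rcases sgn_eq_or s b S with h | h <;> simp [h]

theorem abs_sgn (b : E) (S : G) : |sgn s b S| = 1 := by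
  rcases sgn_eq_or s b S with h | h <;> simp [h]

theorem sgn_mul (b : E) (S T : G) : sgn s b (S * T) = sgn s b S * sgn s b T := by
  simp [sgn]

theorem weight_pos (y : E → ℝ) (S : G) : 0 < weight s y S := Real.exp_pos _

theorem partSum_pos (y : E → ℝ) : 0 < partSum s y :=
  Finset.sum_pos (fun S _ => weight_pos s y S) Finset.univ_nonempty

theorem abs_spinSum_le (b : E) (y : E → ℝ) : |spinSum s b y| ≤ partSum s y := by
  refine (Finset.abs_sum_le_sum_abs _ _).trans (Finset.sum_le_sum fun S _ => ?_)
  rw [abs_mul, abs_sgn, one_mul, abs_of_pos (weight_pos s y S)]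

theorem abs_spinMean_le (b : E) (y : E → ℝ) : |spinMean s b y| ≤ 1 := by
  rw [spinMean, abs_div, abs_of_pos (partSum_pos s y)]
  exact (div_le_one (partSum_pos s y)).2 (abs_spinSum_le s b y)

theorem spinMean_mul_partSum (b : E) (y : E → ℝ) :
    spinMean s b y * partSum s y = spinSum s b y :=
  div_mul_cancel₀ _ (partSum_pos s y).ne'

theorem continuous_weight (S : G) : Continuous fun y => weight s y S := by
  unfold weight; fun_prop

theorem continuous_partSum : Continuous (partSum s) :=
  continuous_finsetSum _ fun S _ => continuous_weight s S

theorem continuous_spinSum (b : E) : Continuous (spinSum s b) :=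
  continuous_finsetSum _ fun S _ => continuous_const.mul (continuous_weight s S)

theorem continuous_spinMean (b : E) : Continuous (spinMean s b) :=
  (continuous_spinSum s b).div (continuous_partSum s) fun y => (partSum_pos s y).ne'

/-! ### Gauge symmetry, planting, and Nishimori's identity. -/

/-- The gauge transformation `y_b ↦ S_b y_b`. -/
def gauge (T : G) (y : E → ℝ) : E → ℝ := fun b => y b * sgn s b T

theorem weight_gauge (T S : G) (y : E → ℝ) : weight s (gauge s T y) S = weight s y (T * S) := by
  simp only [weight, gauge, sgn_mul, mul_assoc]

theorem partSum_gauge (T : G) (y : E → ℝ) : partSum s (gauge s T y) = partSum s y := by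
  simp only [partSum, weight_gauge]
  exact Fintype.sum_equiv (Equiv.mulLeft T) _ _ fun S => rfl

theorem spinSum_gauge (b : E) (T : G) (y : E → ℝ) :
    spinSum s b (gauge s T y) = sgn s b T * spinSum s b y := by
  simp only [spinSum, weight_gauge, Finset.mul_sum]
  refine Fintype.sum_equiv (Equiv.mulLeft T) _ _ fun S => ?_
  simp only [Equiv.coe_mulLeft, sgn_mul]
  rw [← mul_assoc, ← mul_assoc, sgn_mul_self, one_mul]

theorem spinMean_gauge (b : E) (T : G) (y : E → ℝ) :
    spinMean s b (gauge s T y) = sgn s b T * spinMean s b y := by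
  rw [spinMean, spinSum_gauge, partSum_gauge, mul_div_assoc, spinMean]

theorem measurePreserving_gauge (v : E → ℝ≥0) (T : G) :
    MeasurePreserving (gauge s T) (noise v) (noise v) := by
  refine ⟨by unfold gauge; fun_prop, ?_⟩
  have h : ∀ b : E, (gaussianReal 0 (v b)).map (fun x => x * sgn s b T) = gaussianReal 0 (v b) := by
    intro b
    rcases sgn_eq_or s b T with h | h
    · simp [h]
    · simp only [h, mul_neg, mul_one]
      simpa using gaussianReal_map_neg (μ := 0) (v := v b)
  have : ∀ b : E, SigmaFinite ((gaussianReal 0 (v b)).map (fun x => x * sgn s b T)) := by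
    intro b; rw [h]; infer_instance
  unfold noise gauge
  rw [Measure.pi_map_pi (μ := fun b => gaussianReal 0 (v b))
    (f := fun b x => x * sgn s b T) (fun b => by fun_prop)]
  simp [h]

/-- Completing the square compares the two densities. The case `v = 0` is needed because bonds may
be switched off; there both measures are the Dirac mass at `0`, where the weight is `1`. -/
theorem gaussianReal_self_eq_withDensity (v : ℝ≥0) :
    gaussianReal v v =
      (gaussianReal 0 v).withDensity fun y => ENNReal.ofReal (Real.exp (y - v / 2)) := by
  by_cases hv : v = 0
  · subst hv
    simp only [gaussianReal_zero_var, NNReal.coe_zero]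
    rw [dirac_withDensity]
    simp
  · rw [gaussianReal_of_var_ne_zero _ hv, gaussianReal_of_var_ne_zero _ hv,
      ← withDensity_mul _ (by fun_prop) (by fun_prop)]
    congr 1
    ext y
    have hv' : (v : ℝ) ≠ 0 := by exact_mod_cast hv
    simp only [gaussianPDF, Pi.mul_apply, gaussianPDFReal_def]
    rw [← ENNReal.ofReal_mul (by positivity), mul_assoc _ (Real.exp _) (Real.exp _), ← Real.exp_add]
    congr 3
    field_simp
    ring

theorem lintegral_pi_prod {μ : E → Measure ℝ} [∀ b, IsProbabilityMeasure (μ b)]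
    {f : E → ℝ → ℝ≥0∞} (hf : ∀ b, Measurable (f b)) :
    ∫⁻ y, ∏ b, f b (y b) ∂(Measure.pi μ) = ∏ b, ∫⁻ x, f b x ∂(μ b) := by
  have h := lintegral_prod_eq_prod_lintegral_of_indepFun Finset.univ
    (fun b (y : E → ℝ) => f b (y b)) (iIndepFun_pi (μ := μ) fun b => (hf b).aemeasurable)
    (fun b => by have := hf b; fun_prop)
  rw [h]
  refine Finset.prod_congr rfl fun b _ => ?_
  exact (measurePreserving_eval μ b).lintegral_comp (hf b)

theorem signal_eq_withDensity (v : E → ℝ≥0) :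
    signal v = (noise v).withDensity
      fun y => ENNReal.ofReal (Real.exp (∑ b, (y b - v b / 2))) := by
  unfold signal
  refine Measure.pi_eq fun t ht => ?_
  rw [withDensity_apply _ (MeasurableSet.univ_pi ht),
    ← lintegral_indicator (MeasurableSet.univ_pi ht)]
  have : ∀ y : E → ℝ, (Set.univ.pi t).indicator
      (fun y => ENNReal.ofReal (Real.exp (∑ b, (y b - v b / 2)))) y
      = ∏ b, (t b).indicator (fun x => ENNReal.ofReal (Real.exp (x - v b / 2))) (y b) := by
    intro y
    by_cases hy : y ∈ Set.univ.pi t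
    · rw [Set.indicator_of_mem hy, Real.exp_sum,
        ENNReal.ofReal_prod_of_nonneg (fun _ _ => (Real.exp_pos _).le)]
      exact Finset.prod_congr rfl fun b _ => by rw [Set.indicator_of_mem (hy b (Set.mem_univ b))]
    · rw [Set.indicator_of_notMem hy]
      simp only [Set.mem_pi, Set.mem_univ, true_implies, not_forall] at hy
      obtain ⟨b, hb⟩ := hy
      exact (Finset.prod_eq_zero (Finset.mem_univ b) (Set.indicator_of_notMem hb _)).symm
  simp_rw [this]
  rw [noise, lintegral_pi_prod (fun b => Measurable.indicator (by fun_prop) (ht b))]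
  refine Finset.prod_congr rfl fun b _ => ?_
  rw [lintegral_indicator (ht b), ← withDensity_apply _ (ht b), ← gaussianReal_self_eq_withDensity]

theorem integral_signal (v : E → ℝ≥0) (F : (E → ℝ) → ℝ) :
    ∫ y, F y ∂(signal v) =
      Real.exp (-∑ b, (v b : ℝ) / 2) * ∫ y, F y * Real.exp (∑ b, y b) ∂(noise v) := by
  rw [signal_eq_withDensity, integral_withDensity_eq_integral_toReal_smul (by fun_prop)
    (by filter_upwards with y using ENNReal.ofReal_lt_top), ← integral_const_mul]
  refine integral_congr_ae (Eventually.of_forall fun y => ?_)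
  simp only [ENNReal.toReal_ofReal (Real.exp_pos _).le, Finset.sum_sub_distrib, smul_eq_mul]
  rw [sub_eq_add_neg, Real.exp_add]
  ring

theorem weight_eq_prod (y : E → ℝ) (S : G) : weight s y S = ∏ b, Real.exp (sgn s b S * y b) := by
  rw [weight, Real.exp_sum]
  exact Finset.prod_congr rfl fun b _ => by rw [mul_comm]

theorem integrable_weight (v : E → ℝ≥0) (S : G) : Integrable (fun y => weight s y S) (noise v) := by
  simp only [weight_eq_prod]
  exact Integrable.fintype_prod (f := fun b x => Real.exp (sgn s b S * x))
    fun b => integrable_exp_mul_gaussianReal _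

/-- Only the squares of the signs enter the Gaussian moment generating function, so every
configuration has the same mean weight. -/
theorem integral_weight (v : E → ℝ≥0) (S : G) :
    ∫ y, weight s y S ∂(noise v) = Real.exp (∑ b, (v b : ℝ) / 2) := by
  simp only [weight_eq_prod, noise]
  rw [integral_fintype_prod_eq_prod (fun b x => Real.exp (sgn s b S * x)), Real.exp_sum]
  refine Finset.prod_congr rfl fun b _ => ?_
  have := congrFun (mgf_id_gaussianReal (μ := 0) (v := v b)) (sgn s b S)
  simp only [mgf, id] at this
  rw [this, sq, sgn_mul_self]
  simp

theorem integrable_partSum (v : E → ℝ≥0) : Integrable (partSum s) (noise v) :=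
  integrable_finsetSum _ fun S _ => integrable_weight s v S

theorem integrable_spinSum (v : E → ℝ≥0) (b : E) : Integrable (spinSum s b) (noise v) :=
  integrable_finsetSum _ fun S _ => (integrable_weight s v S).const_mul _

/-- Averaging over the gauge group: if `F` is bounded and transforms under the gauge group by a
sign `χ`, its quenched average is a planted average. -/
theorem integral_signal_eq_gauge_average (v : E → ℝ≥0) {F : (E → ℝ) → ℝ} (χ : G → ℝ)
    (hF : ∀ T y, F (gauge s T y) = χ T * F y) (hFm : Continuous F) {C : ℝ}
    (hC : ∀ y, |F y| ≤ C) :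
    (Fintype.card G : ℝ) * ∫ y, F y ∂(signal v) =
      Real.exp (-∑ b, (v b : ℝ) / 2) *
        ∫ y, F y * ∑ T, χ T * weight s y T ∂(noise v) := by
  -- Centred noise is gauge invariant, whereas the tilt `exp (∑ y_b)` becomes the Boltzmann weight
  -- of `T`.
  have h1 : ∀ T : G, ∫ y, F y ∂(signal v) = Real.exp (-∑ b, (v b : ℝ) / 2) *
        ∫ y, F y * (χ T * weight s y T) ∂(noise v) := by
    intro T
    have hm := measurePreserving_gauge s v T
    rw [integral_signal]
    conv_lhs => rw [← hm.map_eq]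
    rw [integral_map hm.aemeasurable (by fun_prop)]
    congr 1
    refine integral_congr_ae (Eventually.of_forall fun y => ?_)
    simp only [hF]
    rw [weight]
    simp only [gauge]
    ring
  have h2 : ∀ T : G, Integrable (fun y => F y * (χ T * weight s y T)) (noise v) := fun T =>
    ((integrable_weight s v T).const_mul (χ T)).bdd_mul (c := C) hFm.aestronglyMeasurable
      (Eventually.of_forall hC)
  have h3 := Finset.sum_congr (rfl : (Finset.univ : Finset G) = Finset.univ) fun T _ => h1 T
  rw [Finset.sum_const, nsmul_eq_mul, Finset.card_univ, ← Finset.mul_sum,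
    ← integral_finsetSum _ fun T _ => h2 T] at h3
  rw [h3]
  simp only [Finset.mul_sum]

/-- The gauge average with sign `S_b` rebuilds the numerator of the Gibbs mean, so the integrand is
`A²/Z`. -/
theorem corr_eq_noise (v : E → ℝ≥0) (b : E) :
    (Fintype.card G : ℝ) * corr s v b = Real.exp (-∑ b, (v b : ℝ) / 2) *
        ∫ y, spinMean s b y * spinSum s b y ∂(noise v) :=
  integral_signal_eq_gauge_average s v (sgn s b) (spinMean_gauge s b) (continuous_spinMean s b)
    (abs_spinMean_le s b)

/-- Nishimori's identity. -/
theorem corr_eq_sq (v : E → ℝ≥0) (b : E) :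
    corr s v b = ∫ y, spinMean s b y ^ 2 ∂(signal v) := by
  have h1 := corr_eq_noise s v b
  have h2 := integral_signal_eq_gauge_average s v (F := fun y => spinMean s b y ^ 2) (fun _ => 1)
    (fun T y => by rw [spinMean_gauge, mul_pow, sq (sgn s b T), sgn_mul_self])
    ((continuous_spinMean s b).pow 2) (C := 1)
    (fun y => by rw [abs_pow]; exact pow_le_one₀ (abs_nonneg _) (abs_spinMean_le s b y))
  -- Since `m = A/Z`, the planted integrands `m² Z` and `m A` of the two averages coincide.
  have h3 : ∀ y, spinMean s b y ^ 2 * ∑ T, 1 * weight s y T = spinMean s b y * spinSum s b y := by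
    intro y
    rw [← spinMean_mul_partSum, partSum]
    simp only [one_mul]
    ring
  simp only [h3] at h2
  exact mul_left_cancel₀ (Nat.cast_ne_zero.2 Fintype.card_ne_zero) (h1.trans h2.symm)

theorem integrable_spinMean (v : E → ℝ≥0) (b : E) : Integrable (spinMean s b) (signal v) :=
  Integrable.of_bound (continuous_spinMean s b).aestronglyMeasurable 1
    (Eventually.of_forall (abs_spinMean_le s b))

theorem corr_nonneg (v : E → ℝ≥0) (b : E) : 0 ≤ corr s v b := by
  rw [corr_eq_sq]; exact integral_nonneg fun y => sq_nonneg _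

theorem corr_le_one (v : E → ℝ≥0) (b : E) : corr s v b ≤ 1 := by
  have := integral_mono (integrable_spinMean s v b) (integrable_const (1 : ℝ))
    fun y => (abs_le.1 (abs_spinMean_le s b y)).2
  simpa [corr] using this

/-! ### Monotonicity of correlations in the signal. -/

/-- Centred Gaussians are infinitely divisible. -/
theorem measurePreserving_add_noise (v w : E → ℝ≥0) :
    MeasurePreserving (fun p : (E → ℝ) × (E → ℝ) => p.1 + p.2) ((noise v).prod (noise w))
      (noise (v + w)) := by
  have h1 := measurePreserving_arrowProdEquivProdArrow ℝ ℝ E (fun b => gaussianReal 0 (v b))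
    (fun b => gaussianReal 0 (w b))
  have hc : ∀ b, ((gaussianReal 0 (v b)).prod (gaussianReal 0 (w b))).map (fun p => p.1 + p.2) =
      gaussianReal 0 ((v + w) b) := fun b => by
    have := gaussianReal_conv_gaussianReal (m₁ := 0) (m₂ := 0) (v₁ := v b) (v₂ := w b)
    simpa [Measure.conv] using this
  have : ∀ b, SigmaFinite (((gaussianReal 0 (v b)).prod (gaussianReal 0 (w b))).map
      (fun p => p.1 + p.2)) := fun b => by rw [hc]; infer_instance
  refine ⟨by fun_prop, ?_⟩
  unfold noise
  rw [← h1.map_eq, Measure.map_map (by fun_prop) (MeasurableEquiv.measurable _)]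
  have h2 := Measure.pi_map_pi (μ := fun b => (gaussianReal 0 (v b)).prod (gaussianReal 0 (w b)))
    (f := fun b p => p.1 + p.2) (fun b => by fun_prop)
  simp only [hc] at h2
  exact h2

theorem weight_add (u w : E → ℝ) (S : G) : weight s (u + w) S = weight s u S * weight s w S := by
  simp only [weight, ← Real.exp_add, ← Finset.sum_add_distrib, Pi.add_apply, add_mul]

theorem integral_sum_weight_add (c : G → ℝ) (u : E → ℝ) (w : E → ℝ≥0) :
    ∫ y, ∑ S, c S * weight s (u + y) S ∂(noise w) =
      (∑ S, c S * weight s u S) * Real.exp (∑ b, (w b : ℝ) / 2) := by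
  simp only [weight_add, ← mul_assoc]
  rw [integral_finsetSum _ fun S _ => (integrable_weight s w S).const_mul _, Finset.sum_mul]
  refine Finset.sum_congr rfl fun S _ => ?_
  rw [integral_const_mul, integral_weight]

/-- The quenched correlation increases with the signal: Griffiths' second inequality on the
Nishimori line. -/
theorem corr_mono {v v' : E → ℝ≥0} (h : v ≤ v') (b : E) : corr s v b ≤ corr s v' b := by
  obtain ⟨w, rfl⟩ : ∃ w, v' = v + w := ⟨v' - v, by ext b; simp [h b]⟩
  have hcard : (0 : ℝ) < Fintype.card G := Nat.cast_pos.2 Fintype.card_pos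
  refine le_of_mul_le_mul_left ?_ hcard
  rw [corr_eq_noise, corr_eq_noise]
  have hexp : Real.exp (-∑ b, (v b : ℝ) / 2) =
      Real.exp (-∑ b, ((v + w) b : ℝ) / 2) * Real.exp (∑ b, (w b : ℝ) / 2) := by
    rw [← Real.exp_add]
    simp [add_div, Finset.sum_add_distrib]
  rw [hexp, mul_assoc]
  refine mul_le_mul_of_nonneg_left ?_ (Real.exp_pos _).le
  have hmp := measurePreserving_add_noise v w
  set m := spinMean s b with hm
  have hmc : Continuous m := continuous_spinMean s b
  have hZ : Integrable (fun p : (E → ℝ) × (E → ℝ) => partSum s (p.1 + p.2))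
      ((noise v).prod (noise w)) := hmp.integrable_comp_of_integrable (integrable_partSum s _)
  have hA : Integrable (fun p : (E → ℝ) × (E → ℝ) => spinSum s b (p.1 + p.2))
      ((noise v).prod (noise w)) := hmp.integrable_comp_of_integrable (integrable_spinSum s _ b)
  -- The integrand is the tangent at slope `m(u)` to the convex function `A²/Z`, evaluated at the
  -- noise `u + w`.
  have hl : Integrable (fun p : (E → ℝ) × (E → ℝ) =>
      2 * (m p.1 * spinSum s b (p.1 + p.2)) - m p.1 ^ 2 * partSum s (p.1 + p.2))
      ((noise v).prod (noise w)) := by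
    refine Integrable.sub (Integrable.const_mul ?_ _) ?_
    · exact hA.bdd_mul (c := 1) (by fun_prop) (Eventually.of_forall fun p => abs_spinMean_le s b _)
    · refine hZ.bdd_mul (c := 1) (by fun_prop) (Eventually.of_forall fun p => ?_)
      rw [norm_pow]
      exact pow_le_one₀ (norm_nonneg _) (abs_spinMean_le s b _)
  have hmA : Integrable (fun y => m y * spinSum s b y) (noise (v + w)) :=
    (integrable_spinSum s _ b).bdd_mul (c := 1) hmc.aestronglyMeasurable
      (Eventually.of_forall fun p => abs_spinMean_le s b _)
  have hr := hmp.integrable_comp_of_integrable hmA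
  have hrhs : ∫ y, m y * spinSum s b y ∂(noise (v + w)) =
      ∫ p, m (p.1 + p.2) * spinSum s b (p.1 + p.2) ∂((noise v).prod (noise w)) := by
    conv_lhs => rw [← hmp.map_eq]
    rw [integral_map hmp.aemeasurable]
    rw [hmp.map_eq]; exact hmA.aestronglyMeasurable
  -- For fixed `u`, averaging over `w` multiplies `A(u)` and `Z(u)` by the same exponential; with
  -- `A(u) = m(u) Z(u)` the tangent then averages to `m(u) A(u)` times that factor.
  have hlhs : Real.exp (∑ b, (w b : ℝ) / 2) * ∫ y, m y * spinSum s b y ∂(noise v) =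
      ∫ p, 2 * (m p.1 * spinSum s b (p.1 + p.2)) - m p.1 ^ 2 * partSum s (p.1 + p.2)
        ∂((noise v).prod (noise w)) := by
    rw [integral_prod _ hl, ← integral_const_mul]
    refine integral_congr_ae (Eventually.of_forall fun u => ?_)
    simp only
    have h1 := integral_sum_weight_add s (sgn s b) u w
    have h2 := integral_sum_weight_add s (fun _ => 1) u w
    simp only [one_mul] at h2
    have i1 : Integrable (fun y => spinSum s b (u + y)) (noise w) := by
      simp only [spinSum, weight_add, ← mul_assoc]
      exact integrable_finsetSum _ fun S _ => (integrable_weight s w S).const_mul _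
    have i2 : Integrable (fun y => partSum s (u + y)) (noise w) := by
      simp only [partSum, weight_add]
      exact integrable_finsetSum _ fun S _ => (integrable_weight s w S).const_mul _
    rw [integral_sub ((i1.const_mul _).const_mul _) (i2.const_mul _), integral_const_mul,
      integral_const_mul, integral_const_mul]
    simp only [spinSum, partSum] at *
    rw [h1, h2]
    have h3 := spinMean_mul_partSum s b u
    simp only [spinSum, partSum] at h3
    rw [← h3, ← hm]
    ring
  rw [hlhs, hrhs]
  refine integral_mono hl hr fun p => ?_
  simp only
  rw [← spinMean_mul_partSum, ← hm]
  -- The gap between the function and its tangent is exactly this square times `Z`.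
  have := mul_nonneg (sq_nonneg (m (p.1 + p.2) - m p.1)) (partSum_pos s (p.1 + p.2)).le
  linarith

end SpinSystem

/-! ### Comparison of systems: embeddings and decoupling. -/

/-- The law of a subfamily of independent variables. -/
theorem measurePreserving_comp_injective {E E' : Type*} [Fintype E] [Fintype E']
    (μ : E' → Measure ℝ) [∀ b, IsProbabilityMeasure (μ b)] {ψ : E → E'}
    (hψ : Function.Injective ψ) :
    MeasurePreserving (fun (y : E' → ℝ) b => y (ψ b)) (Measure.pi μ)
      (Measure.pi fun b => μ (ψ b)) := by
  refine ⟨by fun_prop, ?_⟩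
  have h := (iIndepFun_pi (μ := μ) (X := fun _ x => x) (fun b => by fun_prop)).precomp hψ
  rw [iIndepFun_iff_map_fun_eq_pi_map (fun b => (measurable_pi_apply (ψ b)).aemeasurable)] at h
  refine h.trans ?_
  congr 1
  ext1 b
  exact (measurePreserving_eval μ (ψ b)).map_eq

/-- All fibres of a surjective homomorphism are cosets of its kernel, so `k` is the size of the
kernel. -/
theorem sum_comp_surjective {G G' : Type*} [Fintype G] [Fintype G'] [CommGroup G] [CommGroup G']
    (r : G' →* G) (hr : Function.Surjective r) :
    ∃ k : ℝ, 0 < k ∧ ∀ f : G → ℝ, ∑ S, f (r S) = k * ∑ T, f T := by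
  classical
  refine ⟨(Finset.univ.filter fun S => r S = 1).card, ?_, fun f => ?_⟩
  · exact Nat.cast_pos.2 (Finset.card_pos.2 ⟨1, by simp⟩)
  · rw [← Finset.sum_fiberwise_of_maps_to (t := Finset.univ) (g := r) fun _ _ => Finset.mem_univ _,
      Finset.mul_sum]
    refine Finset.sum_congr rfl fun T _ => ?_
    rw [Finset.sum_congr rfl (g := fun _ => f T) fun S hS => by rw [(Finset.mem_filter.1 hS).2],
      Finset.sum_const, nsmul_eq_mul]
    congr 2
    exact MonoidHom.card_fiber_eq_of_mem_range r (hr T) (hr 1)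

section Comparison

variable {E G : Type*} [Fintype E] [Fintype G] [CommGroup G]
variable {E' G' : Type*} [Fintype E'] [Fintype G'] [CommGroup G']

theorem ae_signal_eq_zero (v : E → ℝ≥0) : ∀ᵐ y ∂(signal v), ∀ b, v b = 0 → y b = 0 := by
  rw [ae_all_iff]
  intro b
  by_cases hb : v b = 0
  · have h : ∀ᵐ x ∂(gaussianReal (v b) (v b)), x = 0 := by
      rw [hb, NNReal.coe_zero, gaussianReal_zero_var, ae_dirac_eq]
      simp
    filter_upwards [(Measure.tendsto_eval_ae_ae (μ := fun b => gaussianReal (v b) (v b))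
      (i := b)).eventually h] with y hy _ using hy
  · exact Eventually.of_forall fun y h => absurd h hb

/-- A bond of zero variance has `y_b = 0` almost surely and leaves the Boltzmann weight. The spins
that `r` forgets multiply numerator and partition function by the same constant, which cancels. -/
theorem corr_comp (s : E → G →* ℤˣ) (s' : E' → G' →* ℤˣ) {ψ : E → E'}
    (hψ : Function.Injective ψ) (r : G' →* G) (hr : Function.Surjective r)
    (hs : ∀ b S, s' (ψ b) S = s b (r S)) (v' : E' → ℝ≥0)
    (hv' : ∀ b, b ∉ Set.range ψ → v' b = 0) (b : E) :
    corr s' v' (ψ b) = corr s (fun b => v' (ψ b)) b := by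
  have hmp := measurePreserving_comp_injective (fun b => gaussianReal (v' b) (v' b)) hψ
  obtain ⟨k, hk, hsum⟩ := sum_comp_surjective r hr
  have hsgn : ∀ b S, sgn s' (ψ b) S = sgn s b (r S) := fun b S => by rw [sgn, hs, sgn]
  have hmean : ∀ᵐ y ∂(signal v'), spinMean s' (ψ b) y = spinMean s b (fun b => y (ψ b)) := by
    filter_upwards [ae_signal_eq_zero v'] with y hy
    have hw : ∀ S, weight s' y S = weight s (fun b => y (ψ b)) (r S) := fun S => by
      simp only [weight, ← hsgn]
      congr 1
      refine (Finset.sum_of_injOn ψ hψ.injOn (fun _ _ => Finset.mem_coe.2 (Finset.mem_univ _)) ?_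
        fun _ _ => rfl).symm
      intro c _ hc
      rw [hy c (hv' c (by simpa using hc)), zero_mul]
    rw [spinMean, spinMean, spinSum, spinSum, partSum, partSum]
    simp only [hw, hsgn]
    rw [hsum fun S => sgn s b S * weight s (fun b => y (ψ b)) S,
      hsum fun S => weight s (fun b => y (ψ b)) S, mul_div_mul_left _ _ hk.ne']
  rw [corr, integral_congr_ae hmean, corr, signal, signal, ← hmp.map_eq,
    integral_map hmp.aemeasurable (continuous_spinMean s b).aestronglyMeasurable]

/-- Correlations increase under an embedding of spin systems that increases the signal. -/
theorem corr_le_corr (s : E → G →* ℤˣ) (s' : E' → G' →* ℤˣ) {ψ : E → E'}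
    (hψ : Function.Injective ψ) (r : G' →* G) (hr : Function.Surjective r)
    (hs : ∀ b S, s' (ψ b) S = s b (r S)) (v : E → ℝ≥0) (v' : E' → ℝ≥0)
    (hv : ∀ b, v b ≤ v' (ψ b)) (b : E) :
    corr s v b ≤ corr s' v' (ψ b) := by
  classical
  -- Intermediate system: the larger one with the signal switched off outside the image of `ψ`.
  have h := corr_comp s s' hψ r hr hs (fun c => if c ∈ Set.range ψ then v' c else 0)
    (fun c hc => if_neg hc) b
  simp only [Set.mem_range_self, if_true] at h
  refine (corr_mono s hv b).trans (h.symm.le.trans (corr_mono s' (fun c => ?_) _))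
  split_ifs
  exacts [le_rfl, zero_le]

/-- The linear bound makes the logarithm integrable; the lower half keeps only the term of the
configuration `1`. -/
theorem abs_log_partSum_le (s : E → G →* ℤˣ) (y : E → ℝ) :
    |Real.log (partSum s y)| ≤ ∑ b, |y b| + Real.log (Fintype.card G) := by
  have hle : ∀ S, |∑ b, y b * sgn s b S| ≤ ∑ b, |y b| := fun S =>
    (Finset.abs_sum_le_sum_abs _ _).trans_eq (by simp [abs_mul, abs_sgn])
  have hcard : (1 : ℝ) ≤ Fintype.card G := Nat.one_le_cast.2 Fintype.card_pos
  rw [abs_le]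
  constructor
  · rw [Real.le_log_iff_exp_le (partSum_pos s y)]
    refine le_trans ?_ (Finset.single_le_sum (fun S _ => (weight_pos s y S).le)
      (Finset.mem_univ (1 : G)))
    refine Real.exp_le_exp.2 ?_
    have := (abs_le.1 (hle 1)).1
    have := Real.log_nonneg hcard
    linarith
  · rw [Real.log_le_iff_le_exp (partSum_pos s y), Real.exp_add, Real.exp_log (by linarith)]
    refine (Finset.sum_le_card_nsmul _ _ _ fun S _ =>
      Real.exp_le_exp.2 (abs_le.1 (hle S)).2).trans_eq ?_
    rw [nsmul_eq_mul, Finset.card_univ, mul_comm]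

theorem continuous_log_partSum (s : E → G →* ℤˣ) :
    Continuous fun y => Real.log (partSum s y) :=
  (continuous_partSum s).log fun y => (partSum_pos s y).ne'

theorem integrable_eval_signal (v : E → ℝ≥0) (b : E) :
    Integrable (fun y : E → ℝ => y b) (signal v) := by
  have h := measurePreserving_eval (fun b => gaussianReal (v b) (v b)) b
  exact h.integrable_comp_of_integrable
    (memLp_one_iff_integrable.1 (memLp_id_gaussianReal (μ := v b) (v := v b) 1))

theorem integrable_log_partSum (s : E → G →* ℤˣ) (v : E → ℝ≥0) :
    Integrable (fun y => Real.log (partSum s y)) (signal v) := by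
  refine Integrable.mono' (g := fun y => ∑ b, |y b| + Real.log (Fintype.card G)) ?_
    (continuous_log_partSum s).aestronglyMeasurable
    (Eventually.of_forall fun y => abs_log_partSum_le s y)
  exact (integrable_finsetSum _ fun b _ => (integrable_eval_signal v b).abs).add
    (integrable_const _)

/-- The pressure of non-interacting subsystems is the sum of their pressures. -/
theorem press_eq_sum {I : Type*} [Fintype I] [DecidableEq I] {F H : I → Type*} [∀ i, Fintype (F i)]
    [∀ i, Fintype (H i)] [∀ i, CommGroup (H i)] (s : ∀ i, F i → H i →* ℤˣ)
    (s' : E' → G' →* ℤˣ) (ψ : (Σ i, F i) → E') (hψ : Function.Injective ψ)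
    (r : G' ≃ ∀ i, H i) (hs : ∀ i b S, s' (ψ ⟨i, b⟩) S = s i b (r S i)) (v' : E' → ℝ≥0)
    (hv' : ∀ b, b ∉ Set.range ψ → v' b = 0) :
    press s' v' = ∑ i, press (s i) fun b => v' (ψ ⟨i, b⟩) := by
  have hmp : ∀ i, MeasurePreserving (fun (y : E' → ℝ) b => y (ψ ⟨i, b⟩)) (signal v')
      (signal fun b => v' (ψ ⟨i, b⟩)) := fun i =>
    measurePreserving_comp_injective (fun b => gaussianReal (v' b) (v' b))
      (ψ := fun b => ψ ⟨i, b⟩) (hψ.comp sigma_mk_injective)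
  have hsgn : ∀ i b S, sgn s' (ψ ⟨i, b⟩) S = sgn (s i) b (r S i) := fun i b S => by
    rw [sgn, hs, sgn]
  have hlog : ∀ᵐ y ∂(signal v'), Real.log (partSum s' y) =
      ∑ i, Real.log (partSum (s i) fun b => y (ψ ⟨i, b⟩)) := by
    filter_upwards [ae_signal_eq_zero v'] with y hy
    rw [← Real.log_prod fun i _ => (partSum_pos (s i) _).ne']
    congr 1
    simp only [partSum]
    -- The product of partition functions expands into one sum over families of configurations,
    -- matched with `G'` by `r`.
    rw [Finset.prod_univ_sum, Fintype.piFinset_univ]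
    refine Fintype.sum_equiv r _ _ fun S => ?_
    simp only [weight, ← Real.exp_sum, ← hsgn]
    congr 1
    rw [← Fintype.sum_sigma' fun i b => y (ψ ⟨i, b⟩) * sgn s' (ψ ⟨i, b⟩) S]
    refine (Finset.sum_of_injOn ψ hψ.injOn (fun _ _ => Finset.mem_coe.2 (Finset.mem_univ _)) ?_
      fun _ _ => rfl).symm
    intro c _ hc
    rw [hy c (hv' c (by simpa using hc)), zero_mul]
  rw [press, integral_congr_ae hlog, integral_finsetSum]
  · refine Finset.sum_congr rfl fun i _ => ?_
    rw [press, ← (hmp i).map_eq, integral_map (hmp i).aemeasurable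
      (continuous_log_partSum (s i)).aestronglyMeasurable]
  · exact fun i _ => (hmp i).integrable_comp_of_integrable (integrable_log_partSum (s i) _)

end Comparison

/-! ### Gaussian integration by parts and the derivative of the pressure. -/

section Derivative

variable {E G : Type*} [Fintype E] [Fintype G] [CommGroup G] (s : E → G →* ℤˣ)

theorem hasDerivAt_weight {y : ℝ → E → ℝ} {y' : E → ℝ} {u : ℝ}
    (hy : ∀ b, HasDerivAt (fun u => y u b) (y' b) u) (S : G) :
    HasDerivAt (fun u => weight s (y u) S) (weight s (y u) S * ∑ b, y' b * sgn s b S) u := by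
  unfold weight
  exact (HasDerivAt.fun_sum fun b _ => (hy b).mul_const _).exp

theorem hasDerivAt_partSum {y : ℝ → E → ℝ} {y' : E → ℝ} {u : ℝ}
    (hy : ∀ b, HasDerivAt (fun u => y u b) (y' b) u) :
    HasDerivAt (fun u => partSum s (y u)) (∑ b, y' b * spinSum s b (y u)) u := by
  unfold partSum
  refine HasDerivAt.congr_deriv (HasDerivAt.fun_sum fun S (_ : S ∈ Finset.univ) =>
    hasDerivAt_weight s hy S) ?_
  simp only [spinSum, Finset.mul_sum]
  rw [Finset.sum_comm]
  exact Finset.sum_congr rfl fun S _ => Finset.sum_congr rfl fun b _ => by ring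

theorem hasDerivAt_log_partSum {y : ℝ → E → ℝ} {y' : E → ℝ} {u : ℝ}
    (hy : ∀ b, HasDerivAt (fun u => y u b) (y' b) u) :
    HasDerivAt (fun u => Real.log (partSum s (y u))) (∑ b, y' b * spinMean s b (y u)) u := by
  refine HasDerivAt.congr_deriv ((hasDerivAt_partSum s hy).log (partSum_pos s _).ne') ?_
  rw [Finset.sum_div]
  exact Finset.sum_congr rfl fun b _ => by rw [spinMean, mul_div_assoc]

theorem hasDerivAt_spinMean [DecidableEq E] {y : ℝ → E → ℝ} {b : E} {c u : ℝ}
    (hy : ∀ b', HasDerivAt (fun u => y u b') (if b' = b then c else 0) u) :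
    HasDerivAt (fun u => spinMean s b (y u)) (c * (1 - spinMean s b (y u) ^ 2)) u := by
  have hA : HasDerivAt (fun u => spinSum s b (y u)) (c * partSum s (y u)) u := by
    unfold spinSum
    refine HasDerivAt.congr_deriv (HasDerivAt.fun_sum fun S (_ : S ∈ Finset.univ) =>
      (hasDerivAt_weight s hy S).const_mul (sgn s b S)) ?_
    rw [partSum, Finset.mul_sum]
    refine Finset.sum_congr rfl fun S _ => ?_
    simp only [ite_mul, zero_mul, Finset.sum_ite_eq', Finset.mem_univ, if_true]
    linear_combination (c * weight s (y u) S) * sgn_mul_self s b S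
  have hZ := hasDerivAt_partSum s hy
  simp only [ite_mul, zero_mul, Finset.sum_ite_eq', Finset.mem_univ, if_true] at hZ
  unfold spinMean
  refine HasDerivAt.congr_deriv (hA.div hZ (partSum_pos s _).ne') ?_
  have := (partSum_pos s (y u)).ne'
  field_simp

/-- Gaussian integration by parts. -/
theorem integral_mul_gaussianReal {f f' : ℝ → ℝ} (hf : ∀ x, HasDerivAt f (f' x) x)
    (hf' : Continuous f') {C C' : ℝ} (hC : ∀ x, |f x| ≤ C) (hC' : ∀ x, |f' x| ≤ C') :
    ∫ x, x * f x ∂(gaussianReal 0 1) = ∫ x, f' x ∂(gaussianReal 0 1) := by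
  have hfc : Continuous f := continuous_iff_continuousAt.2 fun x => (hf x).continuousAt
  have i1 : Integrable (fun x => x * f x) (gaussianReal 0 1) :=
    (memLp_one_iff_integrable.1 (memLp_id_gaussianReal (μ := 0) (v := 1) 1)).mul_bdd (c := C)
      hfc.aestronglyMeasurable (Eventually.of_forall hC)
  have i2 : Integrable f' (gaussianReal 0 1) :=
    Integrable.of_bound hf'.aestronglyMeasurable C' (Eventually.of_forall hC')
  have i3 : Integrable f (gaussianReal 0 1) :=
    Integrable.of_bound hfc.aestronglyMeasurable C (Eventually.of_forall hC)
  have hvol : ∀ {g : ℝ → ℝ}, Integrable g (gaussianReal 0 1) →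
      Integrable (fun x => gaussianPDFReal 0 1 x * g x) volume := by
    intro g hg
    rw [gaussianReal_of_var_ne_zero _ one_ne_zero, integrable_withDensity_iff_integrable_smul'
      (measurable_gaussianPDF _ _) (Eventually.of_forall fun x => gaussianPDF_lt_top)] at hg
    simpa [toReal_gaussianPDF] using hg
  have hd : ∀ x, HasDerivAt (fun x => gaussianPDFReal 0 1 x * f x)
      (gaussianPDFReal 0 1 x * f' x - gaussianPDFReal 0 1 x * (x * f x)) x := by
    intro x
    have h1 : HasDerivAt (gaussianPDFReal 0 1) (-(x * gaussianPDFReal 0 1 x)) x := by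
      unfold gaussianPDFReal
      have h2 : HasDerivAt (fun x : ℝ => -(x - 0) ^ 2 / (2 * ((1 : ℝ≥0) : ℝ))) (-x) x := by
        refine HasDerivAt.congr_deriv
          ((((hasDerivAt_id' x).sub_const 0).fun_pow 2).fun_neg.div_const _) ?_
        simp only [NNReal.coe_one]
        ring
      refine HasDerivAt.congr_deriv (h2.exp.const_mul (√(2 * Real.pi * ((1 : ℝ≥0) : ℝ)))⁻¹) ?_
      ring
    refine HasDerivAt.congr_deriv (h1.mul (hf x)) ?_
    ring
  -- With `φ` the standard Gaussian density, `φ' = -xφ`; the total derivative of `φ f` integrates to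
  -- zero.
  have h := integral_eq_zero_of_hasDerivAt_of_integrable hd ((hvol i2).sub (hvol i1)) (hvol i3)
  rw [integral_sub (hvol i2) (hvol i1), sub_eq_zero] at h
  rw [integral_gaussianReal_eq_integral_smul one_ne_zero,
    integral_gaussianReal_eq_integral_smul one_ne_zero]
  simpa using h.symm

/-- Resampling one coordinate preserves a product measure. -/
theorem measurePreserving_update [DecidableEq E] (μ : E → Measure ℝ)
    [∀ b, IsProbabilityMeasure (μ b)] (b : E) :
    MeasurePreserving (fun p : (E → ℝ) × ℝ => Function.update p.1 b p.2)
      ((Measure.pi μ).prod (μ b)) (Measure.pi μ) := by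
  have hm : Measurable (fun p : (E → ℝ) × ℝ => Function.update p.1 b p.2) := by
    refine measurable_pi_iff.2 fun c => ?_
    by_cases h : c = b
    · subst h; simpa using measurable_snd
    · simp only [Function.update_of_ne h]; fun_prop
  refine ⟨hm, (Measure.pi_eq fun t ht => ?_).symm⟩
  rw [Measure.map_apply hm (MeasurableSet.univ_pi ht)]
  have : (fun p : (E → ℝ) × ℝ => Function.update p.1 b p.2) ⁻¹' Set.univ.pi t =
      (Set.univ.pi (Function.update t b Set.univ)) ×ˢ t b := by
    ext p
    simp only [Set.mem_preimage, Set.mem_pi, Set.mem_univ, true_implies, Set.mem_prod]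
    constructor
    · intro h
      refine ⟨fun c => ?_, by simpa using h b⟩
      by_cases hc : c = b
      · subst hc; simp
      · simpa [Function.update_of_ne hc] using h c
    · rintro ⟨h1, h2⟩ c
      by_cases hc : c = b
      · subst hc; simpa using h2
      · simpa [Function.update_of_ne hc] using h1 c
  rw [this, Measure.prod_prod, Measure.pi_pi, ← Finset.prod_erase_mul _ _ (Finset.mem_univ b),
    ← Finset.prod_erase_mul (a := b) Finset.univ (fun c => μ c (t c)) (Finset.mem_univ b)]
  simp only [Function.update_self, measure_univ, mul_one]
  congr 1
  refine Finset.prod_congr rfl fun c hc => ?_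
  rw [Function.update_of_ne (Finset.ne_of_mem_erase hc)]

/-- The observations `x_b² + x_b g_b` on the Nishimori line. -/
def obs (x g : E → ℝ) : E → ℝ := fun b => x b ^ 2 + x b * g b

/-- The squares of the signal strengths. -/
noncomputable def sqv (x : E → ℝ) : E → ℝ≥0 := fun b => ⟨x b ^ 2, sq_nonneg _⟩

theorem measurePreserving_obs (x : E → ℝ) :
    MeasurePreserving (obs x) (noise 1) (signal (sqv x)) := by
  have h : ∀ b : E, (gaussianReal 0 1).map (fun t => x b ^ 2 + x b * t) =
      gaussianReal (sqv x b) (sqv x b) := by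
    intro b
    have h1 := gaussianReal_map_const_mul (μ := 0) (v := 1) (x b)
    have h2 := gaussianReal_map_const_add (μ := 0) (v := sqv x b) (x b ^ 2)
    rw [mul_zero, mul_one] at h1
    have h3 : (gaussianReal 0 1).map (fun t => x b ^ 2 + x b * t) =
        ((gaussianReal 0 1).map (x b * ·)).map (x b ^ 2 + ·) :=
      (Measure.map_map (by fun_prop) (by fun_prop)).symm
    rw [h3, h1]
    refine h2.trans ?_
    rw [zero_add]
    rfl
  have : ∀ b : E, SigmaFinite ((gaussianReal 0 1).map (fun t => x b ^ 2 + x b * t)) :=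
    fun b => by rw [h]; infer_instance
  refine ⟨by unfold obs; fun_prop, ?_⟩
  have h2 := Measure.pi_map_pi (μ := fun _ : E => gaussianReal 0 1)
    (f := fun b t => x b ^ 2 + x b * t) (fun b => by fun_prop)
  simp only [h] at h2
  exact h2

theorem integral_signal_sqv (x : E → ℝ) {F : (E → ℝ) → ℝ} (hF : Continuous F) :
    ∫ y, F y ∂(signal (sqv x)) = ∫ g, F (obs x g) ∂(noise 1) := by
  have h := measurePreserving_obs x
  rw [← h.map_eq, integral_map h.aemeasurable hF.aestronglyMeasurable]

theorem continuous_obs (x : E → ℝ) : Continuous (obs x) := by unfold obs; fun_prop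

theorem integrable_eval_noise (v : E → ℝ≥0) (b : E) :
    Integrable (fun y : E → ℝ => y b) (noise v) := by
  have h := measurePreserving_eval (fun b => gaussianReal 0 (v b)) b
  exact h.integrable_comp_of_integrable
    (memLp_one_iff_integrable.1 (memLp_id_gaussianReal (μ := 0) (v := v b) 1))

theorem integrable_mul_spinMean_obs (x : E → ℝ) (b : E) :
    Integrable (fun g => g b * spinMean s b (obs x g)) (noise 1) :=
  (integrable_eval_noise 1 b).mul_bdd (c := 1)
    ((continuous_spinMean s b).comp (continuous_obs x)).aestronglyMeasurable
    (Eventually.of_forall fun _ => abs_spinMean_le s b _)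

theorem integrable_spinMean_obs (x : E → ℝ) (b : E) :
    Integrable (fun g => spinMean s b (obs x g)) (noise 1) :=
  Integrable.of_bound ((continuous_spinMean s b).comp (continuous_obs x)).aestronglyMeasurable 1
    (Eventually.of_forall fun _ => abs_spinMean_le s b _)

/-- Integration by parts in `g_b` alone produces `x_b (1 - m²)`; Nishimori's identity replaces the
mean of `m²` by the correlation. -/
theorem integral_mul_spinMean (x : E → ℝ) (b : E) :
    ∫ g, g b * spinMean s b (obs x g) ∂(noise 1) = x b * (1 - corr s (sqv x) b) := by
  classical
  have hmp := measurePreserving_update (fun _ : E => gaussianReal 0 1) b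
  have hresample : ∀ F : (E → ℝ) → ℝ, Continuous F → Integrable F (noise 1) →
      ∫ g, F g ∂(noise 1) = ∫ g, ∫ t, F (Function.update g b t) ∂(gaussianReal 0 1) ∂(noise 1) := by
    intro F hF hi
    have h1 := hmp.integrable_comp_of_integrable (g := F) hi
    have h2 := integral_prod _ h1
    refine Eq.trans ?_ h2
    conv_lhs => rw [show (noise 1 : Measure (E → ℝ)) = _ from hmp.map_eq.symm]
    rw [integral_map hmp.aemeasurable hF.aestronglyMeasurable]
    rfl
  have hsq : Continuous fun g => x b * (1 - spinMean s b (obs x g) ^ 2) :=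
    continuous_const.mul (continuous_const.sub
      (((continuous_spinMean s b).comp (continuous_obs x)).pow 2))
  have hsqb : ∀ y, |x b * (1 - spinMean s b y ^ 2)| ≤ |x b| := fun y => by
    rw [abs_mul]
    refine mul_le_of_le_one_right (abs_nonneg _) ?_
    have := sq_abs (spinMean s b y)
    have h1 := abs_spinMean_le s b y
    have h2 := pow_le_one₀ (n := 2) (abs_nonneg _) h1
    rw [abs_le]
    constructor <;> nlinarith [sq_nonneg (spinMean s b y)]
  have hrhs : x b * (1 - corr s (sqv x) b) =
      ∫ g, x b * (1 - spinMean s b (obs x g) ^ 2) ∂(noise 1) := by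
    rw [corr_eq_sq, integral_signal_sqv x (F := fun y => spinMean s b y ^ 2)
        ((continuous_spinMean s b).pow 2), integral_const_mul,
      integral_sub (integrable_const _), integral_const]
    · simp
    · refine Integrable.of_bound (((continuous_spinMean s b).comp
        (continuous_obs x)).pow 2).aestronglyMeasurable 1 (Eventually.of_forall fun g => ?_)
      rw [norm_pow]
      exact pow_le_one₀ (norm_nonneg _) (abs_spinMean_le s b _)
  -- Resampling the coordinate `b` on both sides isolates a one-dimensional Gaussian integral.
  rw [hrhs, hresample (fun g => g b * spinMean s b (obs x g))
    ((continuous_apply b).mul ((continuous_spinMean s b).comp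
    (continuous_obs x))) (integrable_mul_spinMean_obs s x b), hresample _ hsq
    (Integrable.of_bound hsq.aestronglyMeasurable _ (Eventually.of_forall fun g => hsqb _))]
  refine integral_congr_ae (Eventually.of_forall fun g => ?_)
  simp only [Function.update_self]
  refine integral_mul_gaussianReal (C := 1) (C' := |x b|) (fun t => ?_)
    (hsq.comp (continuous_const.update b continuous_id)) (fun t => abs_spinMean_le s b _)
    fun t => hsqb _
  refine hasDerivAt_spinMean s fun c => ?_
  by_cases hc : c = b
  · subst hc
    simp only [obs, Function.update_self, if_true]
    exact (((hasDerivAt_id' t).const_mul (x c)).const_add _).congr_deriv (mul_one _)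
  · simp only [obs, Function.update_of_ne hc, if_neg hc]
    exact hasDerivAt_const _ _

theorem integral_spinMean_obs (x : E → ℝ) (b : E) :
    ∫ g, spinMean s b (obs x g) ∂(noise 1) = corr s (sqv x) b :=
  (integral_signal_sqv x (continuous_spinMean s b)).symm

theorem press_sqv (x : E → ℝ) :
    press s (sqv x) = ∫ g, Real.log (partSum s (obs x g)) ∂(noise 1) :=
  integral_signal_sqv x (continuous_log_partSum s)

/-- The derivative of the pressure along a line of signal strengths. -/
theorem hasDerivAt_press (p q : E → ℝ) (u : ℝ) :
    HasDerivAt (fun u => press s (sqv fun b => p b + u * q b))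
      (∑ b, q b * (p b + u * q b) * (1 + corr s (sqv fun b => p b + u * q b) b)) u := by
  simp only [press_sqv]
  let x : ℝ → E → ℝ := fun u b => p b + u * q b
  have hdiff : ∀ g u, HasDerivAt (fun u => Real.log (partSum s (obs (x u) g)))
      (∑ b, (q b * (2 * x u b + g b)) * spinMean s b (obs (x u) g)) u := by
    intro g u
    refine hasDerivAt_log_partSum s fun b => ?_
    have h1 : HasDerivAt (fun u => p b + u * q b) (q b) u :=
      (((hasDerivAt_id' u).mul_const (q b)).const_add _).congr_deriv (one_mul _)
    exact ((h1.fun_pow 2).add (h1.mul_const (g b))).congr_deriv (by simp only [x]; ring)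
  have hcont : ∀ u, Continuous fun g => Real.log (partSum s (obs (x u) g)) := fun u =>
    (continuous_log_partSum s).comp (continuous_obs _)
  have hmain := hasDerivAt_integral_of_dominated_loc_of_deriv_le (μ := noise (1 : E → ℝ≥0))
    (F := fun u g => Real.log (partSum s (obs (x u) g)))
    (F' := fun u g => ∑ b, (q b * (2 * x u b + g b)) * spinMean s b (obs (x u) g))
    (x₀ := u) (s := Metric.ball u 1)
    (bound := fun g => ∑ b, |q b| * (2 * (|p b| + (|u| + 1) * |q b|) + |g b|))
    (Metric.ball_mem_nhds u one_pos)
    (Eventually.of_forall fun u => (hcont u).aestronglyMeasurable)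
    ((measurePreserving_obs (x u)).integrable_comp_of_integrable (integrable_log_partSum s _))
    (Continuous.aestronglyMeasurable (by
      refine continuous_finsetSum _ fun b _ => ?_
      exact (by fun_prop : Continuous fun g : E → ℝ => q b * (2 * x u b + g b)).mul
        ((continuous_spinMean s b).comp (continuous_obs _))))
    (Eventually.of_forall fun g w hw => by
      refine (norm_sum_le _ _).trans (Finset.sum_le_sum fun b _ => ?_)
      rw [norm_mul, norm_mul]
      have hw' : |w| ≤ |u| + 1 := by
        have h1 := abs_sub_abs_le_abs_sub w u
        have h2 : |w - u| < 1 := by simpa [Real.dist_eq] using hw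
        linarith
      refine (mul_le_of_le_one_right (by positivity) (abs_spinMean_le s b _)).trans ?_
      refine mul_le_mul_of_nonneg_left ?_ (abs_nonneg _)
      refine (norm_add_le _ _).trans (add_le_add_left ?_ _)
      rw [norm_mul, Real.norm_two]
      refine mul_le_mul_of_nonneg_left ?_ zero_le_two
      refine (norm_add_le _ _).trans (add_le_add_right ?_ _)
      rw [norm_mul]
      exact mul_le_mul_of_nonneg_right hw' (abs_nonneg _))
    (integrable_finsetSum _ fun b _ =>
      ((integrable_const _).add (integrable_eval_noise 1 b).abs).const_mul _)
    (Eventually.of_forall fun g w _ => hdiff g w)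
  refine hmain.2.congr_deriv ?_
  have hi : ∀ b, Integrable (fun g => q b * (2 * x u b) * spinMean s b (obs (x u) g)) (noise 1) :=
    fun b => (integrable_spinMean_obs s (x u) b).const_mul _
  have hi' : ∀ b, Integrable (fun g => q b * (g b * spinMean s b (obs (x u) g))) (noise 1) :=
    fun b => (integrable_mul_spinMean_obs s (x u) b).const_mul _
  -- The two terms average to `2x_b corr` and `x_b (1 - corr)`, whose sum is `x_b (1 + corr)`.
  have hsplit : ∀ b g, (q b * (2 * x u b + g b)) * spinMean s b (obs (x u) g) =
      q b * (2 * x u b) * spinMean s b (obs (x u) g) +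
        q b * (g b * spinMean s b (obs (x u) g)) := fun b g => by ring
  simp only [hsplit]
  rw [integral_finsetSum _ fun b _ => (hi b).fun_add (hi' b)]
  refine Finset.sum_congr rfl fun b _ => ?_
  rw [integral_add (hi b) (hi' b), integral_const_mul, integral_const_mul, integral_spinMean_obs,
    integral_mul_spinMean]
  simp only [x]
  ring

end Derivative

/-! ### The lattice model as a spin system; symmetries, cubes and the corridor. -/

section Lattice

variable {d : ℕ}

/-- The bond spins as characters of the group of configurations. -/
def bondChar (Λ : Finset (Site d)) (b : bonds Λ) : Config Λ →* ℤˣ where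
  toFun S := S ⟨Bond.src b.1, src_mem b⟩ * S ⟨Bond.tgt b.1, tgt_mem b⟩
  map_one' := by simp
  map_mul' S T := by simp only [Pi.mul_apply]; exact mul_mul_mul_comm _ _ _ _

theorem mem_bonds {Λ : Finset (Site d)} {b : Bond d} :
    b ∈ bonds Λ ↔ Bond.src b ∈ Λ ∧ Bond.tgt b ∈ Λ := by
  simp [bonds, Bond.src]

/-- Scaling by `x_b/σ` sends mean `σ x_b` and variance `σ²` both to `x_b²`, also when `x_b = 0`, so
the lattice quantities depend on `x` only. -/
theorem measurePreserving_disorder (Λ : Finset (Site d)) {σ : ℝ} (hσ : 0 < σ) (x : Bond d → ℝ) :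
    MeasurePreserving (fun (J : bonds Λ → ℝ) b => x b.1 / σ * J b)
      (disorder Λ (fun b => σ * x b) fun _ => σ) (signal (sqv fun b : bonds Λ => x b.1)) := by
  have h : ∀ b : bonds Λ, (gaussianReal (σ * x b.1) ⟨σ ^ 2, sq_nonneg _⟩).map (x b.1 / σ * ·) =
      gaussianReal (sqv (fun b : bonds Λ => x b.1) b) (sqv (fun b : bonds Λ => x b.1) b) := by
    intro b
    refine (gaussianReal_map_const_mul _).trans ?_
    have h1 : x b.1 / σ * (σ * x b.1) = (sqv (fun b : bonds Λ => x b.1) b : ℝ) := by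
      change _ = x b.1 ^ 2
      field_simp
    rw [h1]
    congr 1
    ext
    change (x b.1 / σ) ^ 2 * σ ^ 2 = x b.1 ^ 2
    field_simp
  have : ∀ b : bonds Λ, SigmaFinite
      ((gaussianReal (σ * x b.1) ⟨σ ^ 2, sq_nonneg _⟩).map (x b.1 / σ * ·)) :=
    fun b => by rw [h]; infer_instance
  refine ⟨by fun_prop, ?_⟩
  have h2 := Measure.pi_map_pi
    (μ := fun b : bonds Λ => gaussianReal (σ * x b.1) ⟨σ ^ 2, sq_nonneg _⟩)
    (f := fun b t => x b.1 / σ * t) (fun b => by fun_prop)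
  simp only [h] at h2
  exact h2

theorem nlBondCorr_eq_corr (Λ : Finset (Site d)) {σ : ℝ} (hσ : 0 < σ) (x : Bond d → ℝ)
    (b : bonds Λ) :
    nlBondCorr Λ (fun _ => σ) x b = corr (bondChar Λ) (sqv fun b => x b.1) b := by
  have h := measurePreserving_disorder Λ hσ x
  rw [corr, ← h.map_eq, integral_map h.aemeasurable
    (continuous_spinMean _ b).aestronglyMeasurable]
  rfl

theorem nlPressure_eq_press (Λ : Finset (Site d)) {σ : ℝ} (hσ : 0 < σ) (x : Bond d → ℝ) :
    nlPressure Λ (fun _ => σ) x = press (bondChar Λ) (sqv fun b => x b.1) := by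
  have h := measurePreserving_disorder Λ hσ x
  rw [press, ← h.map_eq, integral_map h.aemeasurable
    (continuous_log_partSum _).aestronglyMeasurable]
  rfl

theorem sqv_le_sqv {x y : ℝ} (hx : 0 ≤ x) (h : x ≤ y) :
    (⟨x ^ 2, sq_nonneg _⟩ : ℝ≥0) ≤ ⟨y ^ 2, sq_nonneg _⟩ :=
  NNReal.coe_le_coe.1 (pow_le_pow_left₀ hx h 2)

/-- The lattice symmetry permuting the coordinates by `π` and translating by `a`. -/
def moveSite (π : Equiv.Perm (Fin d)) (a : Site d) (n : Site d) : Site d := fun j => n (π j) + a j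

/-- The action of `moveSite` on bonds. -/
def moveBond (π : Equiv.Perm (Fin d)) (a : Site d) (b : Bond d) : Bond d :=
  (moveSite π a b.1, π.symm b.2)

theorem moveSite_injective (π : Equiv.Perm (Fin d)) (a : Site d) :
    Function.Injective (moveSite π a) := by
  intro n m h
  ext j
  simpa [moveSite] using congrFun h (π.symm j)

theorem moveBond_injective (π : Equiv.Perm (Fin d)) (a : Site d) :
    Function.Injective (moveBond π a) := by
  intro b b' h
  rw [moveBond, moveBond, Prod.mk.injEq] at h
  exact Prod.ext (moveSite_injective π a h.1) (π.symm.injective h.2)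

theorem tgt_moveBond (π : Equiv.Perm (Fin d)) (a : Site d) (b : Bond d) :
    Bond.tgt (moveBond π a b) = moveSite π a (Bond.tgt b) := by
  ext j
  simp only [Bond.tgt, moveBond, moveSite, Pi.add_apply, Pi.single_apply, Equiv.eq_symm_apply]
  ring

/-- Monotonicity of the correlations on the Nishimori line in the volume and in the parameters,
up to a lattice symmetry. -/
theorem nlBondCorr_le {Λ Λ' : Finset (Site d)} {σ : ℝ} (hσ : 0 < σ) {x x' : Bond d → ℝ}
    (π : Equiv.Perm (Fin d)) (a : Site d) (hΛ : ∀ n ∈ Λ, moveSite π a n ∈ Λ')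
    (hx : ∀ b ∈ bonds Λ, 0 ≤ x b ∧ x b ≤ x' (moveBond π a b)) (b : bonds Λ) (b' : bonds Λ')
    (hb : moveBond π a b.1 = b'.1) :
    nlBondCorr Λ (fun _ => σ) x b ≤ nlBondCorr Λ' (fun _ => σ) x' b' := by
  have hmem : ∀ c : bonds Λ, moveBond π a c.1 ∈ bonds Λ' := fun c => by
    rw [mem_bonds, tgt_moveBond]
    exact ⟨hΛ _ (src_mem c), hΛ _ (tgt_mem c)⟩
  let ψ : bonds Λ → bonds Λ' := fun c => ⟨moveBond π a c.1, hmem c⟩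
  have hψ : Function.Injective ψ := fun c c' h =>
    Subtype.ext (moveBond_injective π a (congrArg Subtype.val h))
  -- The site map is injective, so restricting configurations along it is surjective.
  let φ : Λ → Λ' := fun n => ⟨moveSite π a n.1, hΛ _ n.2⟩
  have hφ : Function.Injective φ := fun c c' h =>
    Subtype.ext (moveSite_injective π a (congrArg Subtype.val h))
  let r : Config Λ' →* Config Λ :=
    { toFun := fun S => S ∘ φ
      map_one' := rfl
      map_mul' := fun _ _ => rfl }
  obtain rfl : ψ b = b' := Subtype.ext hb
  rw [nlBondCorr_eq_corr Λ hσ, nlBondCorr_eq_corr Λ' hσ]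
  refine corr_le_corr (bondChar Λ) (bondChar Λ') hψ r hφ.surjective_comp_right ?_ _ _
    (fun c => sqv_le_sqv (hx c.1 c.2).1 (hx c.1 c.2).2) b
  intro c S
  change S _ * S _ = S _ * S _
  congr 2
  exact Subtype.ext (tgt_moveBond π a c.1)

theorem mem_cube {a : Site d} {ℓ : ℕ} {n : Site d} :
    n ∈ cube a ℓ ↔ ∀ i, a i + 1 ≤ n i ∧ n i ≤ a i + ℓ := by
  simp [cube]

theorem mem_bigBox {L : ℕ} {n : Site d} :
    n ∈ bigBox d L ↔ ∀ i, 1 ≤ n i ∧ n i ≤ 2 * L := by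
  simp [bigBox, mem_cube]

theorem mem_subBox {L : ℕ} {s : Fin d → Fin 2} {n : Site d} :
    n ∈ subBox L s ↔ ∀ i, (s i = 0 ∧ 1 ≤ n i ∧ n i ≤ L) ∨
      (s i = 1 ∧ (L : ℤ) + 1 ≤ n i ∧ n i ≤ 2 * L) := by
  rw [subBox, mem_cube]
  refine forall_congr' fun i => ?_
  generalize s i = k
  fin_cases k
  · simp
  · simp; omega

theorem subBox_subset (L : ℕ) (s : Fin d → Fin 2) : subBox L s ⊆ bigBox d L := by
  intro n hn
  rw [mem_bigBox]
  rw [mem_subBox] at hn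
  intro i
  rcases hn i with h | h <;> omega

/-- The index of the sub-box containing the site `n`. -/
def boxIndex (L : ℕ) (n : Site d) : Fin d → Fin 2 := fun j => if n j ≤ L then 0 else 1

theorem mem_subBox_boxIndex {L : ℕ} {n : Site d} (hn : n ∈ bigBox d L) :
    n ∈ subBox L (boxIndex L n) := by
  rw [mem_bigBox] at hn
  rw [mem_subBox]
  intro i
  have := hn i
  unfold boxIndex
  split_ifs with h
  · left; exact ⟨rfl, by omega, h⟩
  · right; exact ⟨rfl, by omega, by omega⟩

theorem eq_boxIndex {L : ℕ} {n : Site d} {s : Fin d → Fin 2} (hn : n ∈ subBox L s) :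
    s = boxIndex L n := by
  rw [mem_subBox] at hn
  ext1 i
  unfold boxIndex
  rcases hn i with h | h
  · rw [if_pos h.2.2, h.1]
  · rw [if_neg (by omega), h.1]

theorem tgt_apply_self (b : Bond d) : Bond.tgt b b.2 = b.1 b.2 + 1 := by simp [Bond.tgt]

theorem tgt_apply_of_ne (b : Bond d) {j : Fin d} (h : j ≠ b.2) : Bond.tgt b j = b.1 j := by
  simp [Bond.tgt, h]

/-- A bond moves one coordinate by one, and the sub-box index of that coordinate changes only
between `L` and `L + 1`. -/
theorem mem_corridor {L : ℕ} {b : Bond d} :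
    b ∈ corridor d L ↔ b ∈ bonds (bigBox d L) ∧ b.1 b.2 = L := by
  rw [corridor, Finset.mem_filter]
  refine and_congr_right fun hb => ?_
  rw [mem_bonds] at hb
  have h1 := tgt_apply_self b
  constructor
  · rintro ⟨s, s', hne, hs, hs'⟩
    obtain rfl := eq_boxIndex hs
    obtain rfl := eq_boxIndex hs'
    obtain ⟨j, hj⟩ := Function.ne_iff.1 hne
    by_cases hjb : j = b.2
    · subst hjb
      simp only [boxIndex, h1, Bond.src] at hj
      by_contra hne'
      refine hj (if_congr ?_ rfl rfl)
      omega
    · simp only [boxIndex, tgt_apply_of_ne b hjb, Bond.src] at hj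
      exact absurd rfl hj
  · intro h
    refine ⟨_, _, ?_, mem_subBox_boxIndex hb.1, mem_subBox_boxIndex hb.2⟩
    refine Function.ne_iff.2 ⟨b.2, ?_⟩
    simp [boxIndex, h1, Bond.src, h]

/-! ### The infinite-volume interface correlation and its finite-volume bounds. -/

/-- The centred box of radius `R`. -/
noncomputable def centredBox (d R : ℕ) : Finset (Site d) := cube (fun _ => -(R : ℤ) - 1) (2 * R + 1)

theorem mem_centredBox {R : ℕ} {n : Site d} : n ∈ centredBox d R ↔ ∀ i, |n i| ≤ (R : ℤ) := by
  rw [centredBox, mem_cube]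
  refine forall_congr' fun i => ?_
  rw [abs_le]
  push_cast
  constructor <;> intro h <;> omega

/-- The parameters of an infinite system divided into two half-spaces orthogonal to `e_i`. -/
noncomputable def planeParam (i : Fin d) (x t : ℝ) (b : Bond d) : ℝ :=
  if b.2 = i ∧ b.1 i = 0 then x * Real.sqrt t else x

/-- The shift to radius `R + 1` leaves room for both endpoints even when `R = 0`. -/
theorem centralBond_mem (i : Fin d) (R : ℕ) : ((0, i) : Bond d) ∈ bonds (centredBox d (R + 1)) := by
  rw [mem_bonds, mem_centredBox, mem_centredBox]
  refine ⟨fun j => by simp only [Bond.src, Pi.zero_apply, abs_zero]; positivity, fun j => ?_⟩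
  simp only [Bond.tgt, zero_add, Pi.single_apply]
  split_ifs
  · simp
  · simp only [abs_zero]; positivity

/-- The correlation across the dividing plane in a centred box. -/
noncomputable def planeCorr (i : Fin d) (σ x : ℝ) (R : ℕ) (t : ℝ) : ℝ :=
  nlBondCorr (centredBox d (R + 1)) (fun _ => σ) (planeParam i x t) ⟨(0, i), centralBond_mem i R⟩

/-- The infinite-volume correlation across the dividing plane. -/
noncomputable def interfaceCorr (i : Fin d) (σ x : ℝ) (t : ℝ) : ℝ := ⨆ R, planeCorr i σ x R t

theorem mul_sqrt_le {x t : ℝ} (hx : 0 ≤ x) (ht : t ≤ 1) : x * Real.sqrt t ≤ x :=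
  mul_le_of_le_one_right hx (Real.sqrt_le_one.2 ht)

theorem planeParam_nonneg (i : Fin d) {x : ℝ} (hx : 0 ≤ x) (t : ℝ) (b : Bond d) :
    0 ≤ planeParam i x t b := by
  unfold planeParam; split_ifs <;> positivity

theorem cutParam_nonneg (L : ℕ) {x : ℝ} (hx : 0 ≤ x) (t : ℝ) (b : Bond d) :
    0 ≤ cutParam d L x t b := by
  unfold cutParam; split_ifs <;> positivity

theorem moveSite_one_zero (n : Site d) : moveSite (1 : Equiv.Perm (Fin d)) 0 n = n := by
  ext j; simp [moveSite]

theorem moveBond_one_zero (b : Bond d) : moveBond (1 : Equiv.Perm (Fin d)) 0 b = b := by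
  ext1
  · exact moveSite_one_zero _
  · rfl

theorem planeCorr_mono (i : Fin d) {σ x : ℝ} (hσ : 0 < σ) (hx : 0 ≤ x) (R : ℕ) :
    Monotone (planeCorr i σ x R) := by
  intro t t' h
  refine nlBondCorr_le hσ 1 0 (fun n hn => ?_) (fun b _ => ?_) _ _ (moveBond_one_zero _)
  · rwa [moveSite_one_zero]
  · rw [moveBond_one_zero]
    refine ⟨planeParam_nonneg i hx t b, ?_⟩
    unfold planeParam
    split_ifs
    · exact mul_le_mul_of_nonneg_left (Real.sqrt_le_sqrt h) hx
    · exact le_rfl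

theorem nlBondCorr_cutParam_mono {L : ℕ} {σ x : ℝ} (hσ : 0 < σ) (hx : 0 ≤ x)
    (b : bonds (bigBox d L)) :
    Monotone fun t => nlBondCorr (bigBox d L) (fun _ => σ) (cutParam d L x t) b := by
  intro t t' h
  refine nlBondCorr_le hσ 1 0 (fun n hn => ?_) (fun b _ => ?_) _ _ (moveBond_one_zero _)
  · rwa [moveSite_one_zero]
  · rw [moveBond_one_zero]
    refine ⟨cutParam_nonneg L hx t b, ?_⟩
    unfold cutParam
    split_ifs
    · exact mul_le_mul_of_nonneg_left (Real.sqrt_le_sqrt h) hx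
    · exact le_rfl

theorem nlBondCorr_nonneg (Λ : Finset (Site d)) {σ : ℝ} (hσ : 0 < σ) (x : Bond d → ℝ)
    (b : bonds Λ) : 0 ≤ nlBondCorr Λ (fun _ => σ) x b := by
  rw [nlBondCorr_eq_corr Λ hσ]; exact corr_nonneg _ _ _

theorem nlBondCorr_le_one (Λ : Finset (Site d)) {σ : ℝ} (hσ : 0 < σ) (x : Bond d → ℝ)
    (b : bonds Λ) : nlBondCorr Λ (fun _ => σ) x b ≤ 1 := by
  rw [nlBondCorr_eq_corr Λ hσ]; exact corr_le_one _ _ _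

theorem bddAbove_planeCorr (i : Fin d) {σ x : ℝ} (hσ : 0 < σ) (t : ℝ) :
    BddAbove (Set.range fun R => planeCorr i σ x R t) :=
  ⟨1, by rintro _ ⟨R, rfl⟩; exact nlBondCorr_le_one _ hσ _ _⟩

theorem planeCorr_le_interfaceCorr (i : Fin d) {σ x : ℝ} (hσ : 0 < σ) (R : ℕ) (t : ℝ) :
    planeCorr i σ x R t ≤ interfaceCorr i σ x t :=
  le_ciSup (bddAbove_planeCorr i hσ t) R

theorem interfaceCorr_nonneg (i : Fin d) {σ x : ℝ} (hσ : 0 < σ) (t : ℝ) :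
    0 ≤ interfaceCorr i σ x t :=
  (nlBondCorr_nonneg _ hσ _ _).trans (planeCorr_le_interfaceCorr i hσ 0 t)

theorem interfaceCorr_mono (i : Fin d) {σ x : ℝ} (hσ : 0 < σ) (hx : 0 ≤ x) :
    Monotone (interfaceCorr i σ x) := fun _ t' h =>
  ciSup_mono (bddAbove_planeCorr i hσ t') fun R => planeCorr_mono i hσ hx R h

theorem FarCorridorBond.mem_corridor {L R : ℕ} {b : Bond d} (h : FarCorridorBond L R b) :
    b ∈ corridor d L := by
  obtain ⟨s, s', hne, hs, hs', -⟩ := h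
  rw [corridor, Finset.mem_filter, mem_bonds]
  exact ⟨⟨subBox_subset L s hs, subBox_subset L s' hs'⟩, s, s', hne, hs, hs'⟩

/-- Near a bond far from the outer boundary the corridor is the dividing plane. -/
theorem planeCorr_le_nlBondCorr (i : Fin d) {σ x t : ℝ} (hσ : 0 < σ) (hx : 0 ≤ x) (ht : t ≤ 1)
    {L R : ℕ} (b : bonds (bigBox d L)) (hb : FarCorridorBond L (R + 1) b.1) :
    planeCorr i σ x R t ≤ nlBondCorr (bigBox d L) (fun _ => σ) (cutParam d L x t) b := by
  have hbC := hb.mem_corridor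
  have hbL := (EA.mem_corridor.1 hbC).2
  obtain ⟨s, s', hne, hs, hs', hball⟩ := hb
  obtain ⟨⟨n, k⟩, hbm⟩ := b
  have hball' : ∀ m ∈ centredBox d (R + 1), moveSite (Equiv.swap i k) n m ∈
      subBox L s ∪ subBox L s' := by
    intro m hm
    rw [mem_centredBox] at hm
    exact hball _ fun j => by simpa [moveSite, Bond.src] using hm _
  -- The swap turns the reference direction `i` into the direction `k` of the bond, so one function
  -- serves all directions.
  refine nlBondCorr_le hσ (Equiv.swap i k) n (fun m hm => ?_) (fun c hc => ?_) _ _ ?_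
  · exact Finset.union_subset (subBox_subset L s) (subBox_subset L s') (hball' m hm)
  · refine ⟨planeParam_nonneg i hx t c, ?_⟩
    unfold cutParam planeParam
    split_ifs with h1 h2 h2
    · exact le_rfl
    · exact mul_sqrt_le hx ht
    · exfalso
      apply h1
      rw [EA.mem_corridor] at h2
      rw [mem_bonds] at hc
      have hm1 := hball' _ hc.1
      have hm2 := hball' _ hc.2
      rw [← tgt_moveBond] at hm2
      obtain ⟨-, h2⟩ := h2
      set e := moveBond (Equiv.swap i k) n c with he
      have hsrc : moveSite (Equiv.swap i k) n (Bond.src c) = e.1 := rfl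
      rw [hsrc] at hm1
      -- The two cubes have the same index off `k`; a corridor bond in another direction would
      -- change such an index while staying in their union.
      have hek : e.2 = k := by
        by_contra hek
        have hss : s e.2 = s' e.2 := by
          rw [eq_boxIndex hs, eq_boxIndex hs', boxIndex, boxIndex,
            tgt_apply_of_ne (n, k) hek, Bond.src]
        have q1 : boxIndex L e.1 e.2 = s e.2 := by
          rcases Finset.mem_union.1 hm1 with h | h
          · rw [← eq_boxIndex h]
          · rw [← eq_boxIndex h, hss]
        have q2 : boxIndex L (Bond.tgt e) e.2 = s e.2 := by
          rcases Finset.mem_union.1 hm2 with h | h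
          · rw [← eq_boxIndex h]
          · rw [← eq_boxIndex h, hss]
        rw [← q1] at q2
        simp [boxIndex, tgt_apply_self, h2] at q2
      have hci : c.2 = i := by
        have : (Equiv.swap i k).symm c.2 = k := hek
        rw [Equiv.symm_apply_eq] at this
        simpa using this
      refine ⟨hci, ?_⟩
      rw [hek] at h2
      have h3 : c.1 ((Equiv.swap i k) k) + n k = L := h2
      have h4 : n k = L := hbL
      rw [Equiv.swap_apply_right] at h3
      omega
    · exact le_rfl
  · ext1
    · ext j; simp [moveBond, moveSite]
    · simp [moveBond]

/-- Centred at the bond, the whole big box fits into a centred box. There all of its bonds in the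
dividing plane come from the corridor, and corridor bonds off that plane can only gain signal. No
distance from the boundary is needed. -/
theorem nlBondCorr_le_interfaceCorr (i : Fin d) {σ x t : ℝ} (hσ : 0 < σ) (hx : 0 ≤ x) (ht : t ≤ 1)
    {L : ℕ} (b : bonds (bigBox d L)) (hb : b.1 ∈ corridor d L) :
    nlBondCorr (bigBox d L) (fun _ => σ) (cutParam d L x t) b ≤ interfaceCorr i σ x t := by
  -- Two sites of the big box differ by less than `2L` in each coordinate, so this radius suffices.
  refine le_trans ?_ (planeCorr_le_interfaceCorr i hσ (2 * L) t)
  have hbL := (EA.mem_corridor.1 hb).2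
  obtain ⟨⟨n, k⟩, hbm⟩ := b
  refine nlBondCorr_le hσ (Equiv.swap i k) (fun j => -n (Equiv.swap i k j)) (fun m hm => ?_)
    (fun c hc => ?_) _ _ ?_
  · have hn := (mem_bonds.1 hbm).1
    rw [mem_bigBox] at hm hn
    rw [mem_centredBox]
    intro j
    have h1 := hm (Equiv.swap i k j)
    have h2 := hn (Equiv.swap i k j)
    simp only [moveSite, Bond.src] at *
    rw [abs_le]
    push_cast
    constructor <;> omega
  · refine ⟨cutParam_nonneg L hx t c, ?_⟩
    unfold cutParam planeParam
    split_ifs with h1 h2 h2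
    · exact le_rfl
    · exact mul_sqrt_le hx ht
    · exfalso
      apply h1
      rw [EA.mem_corridor]
      refine ⟨hc, ?_⟩
      have hck : c.2 = k := by
        have : (Equiv.swap i k).symm c.2 = i := h2.1
        rw [Equiv.symm_apply_eq] at this
        simpa using this
      have h3 : c.1 (Equiv.swap i k i) + -n (Equiv.swap i k i) = 0 := h2.2
      rw [Equiv.swap_apply_left] at h3
      have h4 : n k = L := hbL
      rw [hck]
      omega
    · exact le_rfl
  · ext1
    · ext j; simp [moveBond, moveSite]
    · simp [moveBond]

end Lattice

/-! ### The adjacency pressure: interpolation, counting and the limit. -/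

section Adjacency

variable {d : ℕ}

theorem mem_bonds_subBox {L : ℕ} {b : Bond d} (hb : b ∈ bonds (bigBox d L))
    (h : b ∉ corridor d L) : b ∈ bonds (subBox L (boxIndex L b.1)) := by
  have hb' := mem_bonds.1 hb
  have h1 := mem_subBox_boxIndex hb'.1
  have h2 := mem_subBox_boxIndex hb'.2
  rw [mem_bonds]
  refine ⟨h1, ?_⟩
  by_contra h3
  apply h
  rw [corridor, Finset.mem_filter]
  refine ⟨hb, _, _, fun heq => h3 ?_, h1, h2⟩
  rw [← heq] at h2
  exact h2

theorem notMem_corridor {L : ℕ} {s : Fin d → Fin 2} {b : Bond d} (hb : b ∈ bonds (subBox L s)) :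
    b ∉ corridor d L := by
  rw [mem_bonds] at hb
  intro h
  have hL := (mem_corridor.1 h).2
  have h1 := congrFun ((eq_boxIndex hb.1).symm.trans (eq_boxIndex hb.2)) b.2
  simp [boxIndex, tgt_apply_self, Bond.src, hL] at h1

theorem bonds_mono {Λ Λ' : Finset (Site d)} (h : Λ ⊆ Λ') : bonds Λ ⊆ bonds Λ' := fun b hb => by
  rw [mem_bonds] at hb ⊢
  exact ⟨h hb.1, h hb.2⟩

/-- A configuration of the big box is a family of configurations of the sub-boxes. -/
noncomputable def configEquiv (d L : ℕ) :
    Config (bigBox d L) ≃ ∀ s : Fin d → Fin 2, Config (subBox L s) where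
  toFun S s n := S ⟨n.1, subBox_subset L s n.2⟩
  invFun T n := T (boxIndex L n.1) ⟨n.1, mem_subBox_boxIndex n.2⟩
  left_inv _ := rfl
  right_inv T := by
    ext s n
    have h : ∀ s', s' = s → ∀ hn, T s' ⟨n.1, hn⟩ = T s n := by
      rintro _ rfl _
      rfl
    exact congrArg _ (h _ (eq_boxIndex n.2).symm _)

/-- Without the corridor the sub-boxes decouple. -/
theorem nlPressure_cutParam_zero (L : ℕ) {σ : ℝ} (hσ : 0 < σ) (x : ℝ) :
    nlPressure (bigBox d L) (fun _ => σ) (cutParam d L x 0) =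
      ∑ s : Fin d → Fin 2, nlPressure (subBox L s) (fun _ => σ) fun _ => x := by
  rw [nlPressure_eq_press _ hσ]
  let ψ : (Σ s : Fin d → Fin 2, bonds (subBox L s)) → bonds (bigBox d L) :=
    fun p => ⟨p.2.1, bonds_mono (subBox_subset L p.1) p.2.2⟩
  have hψ : Function.Injective ψ := by
    rintro ⟨s, b, hb⟩ ⟨s', b', hb'⟩ h
    obtain rfl : b = b' := congrArg Subtype.val h
    obtain rfl : s = s' :=
      (eq_boxIndex (mem_bonds.1 hb).1).trans (eq_boxIndex (mem_bonds.1 hb').1).symm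
    rfl
  have hs : ∀ (s : Fin d → Fin 2) (b : bonds (subBox L s)) (S : Config (bigBox d L)),
      bondChar (bigBox d L) (ψ ⟨s, b⟩) S = bondChar (subBox L s) b (configEquiv d L S s) :=
    fun _ _ _ => rfl
  refine (press_eq_sum (fun s : Fin d → Fin 2 => bondChar (subBox L s)) (bondChar (bigBox d L)) ψ hψ
    (configEquiv d L) hs _ ?_).trans ?_
  rotate_left
  · refine Finset.sum_congr rfl fun s _ => ?_
    rw [nlPressure_eq_press _ hσ]
    refine congrArg (press (bondChar (subBox L s))) (funext fun b => NNReal.eq ?_)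
    change cutParam d L x 0 b.1 ^ 2 = x ^ 2
    rw [cutParam, if_neg (notMem_corridor b.2)]
  · intro b hb
    -- Bonds inside no sub-box are corridor bonds, where `√0` removes the variance.
    have hbC : b.1 ∈ corridor d L := by
      by_contra h
      exact hb ⟨⟨_, b.1, mem_bonds_subBox b.2 h⟩, rfl⟩
    ext
    change cutParam d L x 0 b.1 ^ 2 = 0
    rw [cutParam, if_pos hbC]
    simp

/-- The derivative of the pressure with respect to the interpolation parameter, without the
factor `x² / 2`. -/
noncomputable def corridorSum (d L : ℕ) (σ x t : ℝ) : ℝ :=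
  ∑ b : bonds (bigBox d L), if b.1 ∈ corridor d L then
    1 + nlBondCorr (bigBox d L) (fun _ => σ) (cutParam d L x t) b else 0

theorem corridorSum_mono (L : ℕ) {σ x : ℝ} (hσ : 0 < σ) (hx : 0 ≤ x) :
    Monotone (corridorSum d L σ x) := fun t t' h => by
  refine Finset.sum_le_sum fun b _ => ?_
  split_ifs
  · have := nlBondCorr_cutParam_mono hσ hx b h
    simp only at this
    linarith
  · exact le_rfl

/-- The interpolation parameter enters through `u = √t`. The factor `x²√t` in the derivative of the
pressure cancels against `1/(2√t)`, leaving `x²/2`. -/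
theorem adjacencyPressure_eq_integral (L : ℕ) {β σ : ℝ} (hβ : 0 ≤ β) (hσ : 0 < σ) :
    adjacencyPressure d β σ L =
      ∫ t in (0 : ℝ)..1, (β * σ) ^ 2 / 2 * corridorSum d L σ (β * σ) t := by
  classical
  set x := β * σ with hxdef
  have hx : 0 ≤ x := by positivity
  let p : bonds (bigBox d L) → ℝ := fun b => if b.1 ∈ corridor d L then 0 else x
  let q : bonds (bigBox d L) → ℝ := fun b => if b.1 ∈ corridor d L then x else 0
  have hpq : ∀ t, (fun b : bonds (bigBox d L) => cutParam d L x t b.1) =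
      fun b => p b + Real.sqrt t * q b := by
    intro t
    ext b
    simp only [cutParam, p, q]
    split_ifs <;> ring
  let F : ℝ → ℝ := fun u => press (bondChar (bigBox d L)) (sqv fun b => p b + u * q b)
  have hF : ∀ t, nlPressure (bigBox d L) (fun _ => σ) (cutParam d L x t) = F (Real.sqrt t) := by
    intro t
    rw [nlPressure_eq_press _ hσ, hpq]
  have hFd := hasDerivAt_press (bondChar (bigBox d L)) p q
  have hFc : Continuous F := continuous_iff_continuousAt.2 fun u => (hFd u).continuousAt
  have h1 : nlPressure (bigBox d L) (fun _ => σ) (fun _ => x) =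
      nlPressure (bigBox d L) (fun _ => σ) (cutParam d L x 1) := by
    congr 1
    ext b
    simp [cutParam]
  rw [adjacencyPressure, ← nlPressure_cutParam_zero L hσ, h1, hF, hF]
  symm
  -- As `√t` is not differentiable at `0`, the derivative is taken in the open interval and
  -- continuity covers the endpoints; monotonicity in `t` gives integrability.
  refine intervalIntegral.integral_eq_sub_of_hasDerivAt_of_le zero_le_one
    (f := fun t => F (Real.sqrt t)) (hFc.comp Real.continuous_sqrt).continuousOn (fun t ht => ?_)
    (((corridorSum_mono L hσ hx).intervalIntegrable).const_mul _)
  refine ((hFd (Real.sqrt t)).comp t (Real.hasDerivAt_sqrt ht.1.ne')).congr_deriv ?_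
  rw [Finset.sum_mul, corridorSum, Finset.mul_sum]
  refine Finset.sum_congr rfl fun b _ => ?_
  rw [nlBondCorr_eq_corr _ hσ, hpq]
  have hs := Real.sqrt_pos.2 ht.1
  by_cases hb : b.1 ∈ corridor d L
  · simp only [p, q, hb, if_true, zero_add]
    field_simp
  · simp only [q, hb, if_false]
    ring

theorem card_corridor {L : ℕ} (hL : 1 ≤ L) : (corridor d L).card = d * (2 * L) ^ (d - 1) := by
  classical
  rw [Finset.card_eq_sum_card_fiberwise (f := Prod.snd) (t := Finset.univ)
    fun _ _ => Finset.mem_coe.2 (Finset.mem_univ _)]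
  rw [Finset.sum_congr rfl (g := fun _ => (2 * L) ^ (d - 1)), Finset.sum_const, Finset.card_univ,
    Fintype.card_fin, smul_eq_mul]
  intro k _
  have h : (corridor d L).filter (fun b => b.2 = k) =
      (Fintype.piFinset fun j => if j = k then {(L : ℤ)} else Finset.Icc 1 (2 * (L : ℤ))).image
        fun n => ((n, k) : Bond d) := by
    ext ⟨n, k'⟩
    simp only [Finset.mem_filter, mem_corridor, mem_bonds, mem_bigBox, Finset.mem_image,
      Fintype.mem_piFinset, Prod.mk.injEq]
    constructor
    · rintro ⟨⟨⟨h1, -⟩, h2⟩, rfl⟩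
      refine ⟨n, fun j => ?_, rfl, rfl⟩
      split_ifs with h
      · subst h; simpa using h2
      · simpa [Bond.src] using h1 j
    · rintro ⟨m, hm, rfl, rfl⟩
      have hk := hm k
      simp only [if_true, Finset.mem_singleton] at hk
      have hj : ∀ j, j ≠ k → 1 ≤ m j ∧ m j ≤ 2 * L := fun j hj => by
        have := hm j
        simpa [hj] using this
      refine ⟨⟨⟨fun j => ?_, fun j => ?_⟩, hk⟩, rfl⟩
      · by_cases h : j = k
        · subst h; simp only [Bond.src]; omega
        · exact hj j h
      · by_cases h : j = k
        · subst h
          rw [show Bond.tgt (m, j) j = m j + 1 from tgt_apply_self _]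
          omega
        · rw [tgt_apply_of_ne _ h]; exact hj j h
  rw [h, Finset.card_image_of_injective _ fun _ _ h => (Prod.mk.inj h).1, Fintype.card_piFinset,
    ← Finset.mul_prod_erase _ _ (Finset.mem_univ k)]
  rw [Finset.prod_congr rfl (g := fun _ => 2 * L), Finset.prod_const,
    Finset.card_erase_of_mem (Finset.mem_univ k)]
  · simp
  · intro j hj
    rw [if_neg (Finset.ne_of_mem_erase hj), Int.card_Icc]
    omega

/-- The tangential coordinates keep distance `R` from the ends of both halves of `{1, …, 2L}`,
leaving `2 (L - 2R)` values each (none if `L ≤ 2R`). The bound `R + 1 ≤ L` gives room in the normal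
direction. -/
theorem exists_farCorridorBond_card {L R : ℕ} (hL : R + 1 ≤ L) :
    ∃ A ⊆ bonds (bigBox d L), (∀ b ∈ A, FarCorridorBond L R b) ∧
      A.card = d * (2 * (L - 2 * R)) ^ (d - 1) := by
  classical
  let I : Finset ℤ := Finset.Icc ((R : ℤ) + 1) (L - R) ∪ Finset.Icc ((L : ℤ) + R + 1) (2 * L - R)
  have hI : I.card = 2 * (L - 2 * R) := by
    rw [Finset.card_union_of_disjoint]
    · simp only [Int.card_Icc]; omega
    · rw [Finset.disjoint_left]
      intro a ha hb
      rw [Finset.mem_Icc] at ha hb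
      omega
  let P : Fin d → Finset (Site d) := fun k =>
    Fintype.piFinset fun j => if j = k then {(L : ℤ)} else I
  have hP : ∀ {n k}, n ∈ P k ↔ n k = L ∧ ∀ j, j ≠ k → n j ∈ I := by
    intro n k
    simp only [P, Fintype.mem_piFinset]
    constructor
    · intro h
      refine ⟨by simpa using h k, fun j hj => by simpa [hj] using h j⟩
    · rintro ⟨h1, h2⟩ j
      split_ifs with h
      · subst h; simpa using h1
      · exact h2 j h
  let A : Finset (Bond d) := (Finset.univ.sigma P).image fun p => (p.2, p.1)
  have hfar : ∀ b ∈ A, FarCorridorBond L R b := by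
    intro b hb
    obtain ⟨⟨k, n⟩, hn, rfl⟩ := Finset.mem_image.1 hb
    obtain ⟨hk, hj⟩ : n k = L ∧ ∀ j, j ≠ k → n j ∈ I := hP.1 (Finset.mem_sigma.1 hn).2
    have hI' : ∀ j, j ≠ k → ((R : ℤ) + 1 ≤ n j ∧ n j ≤ L - R) ∨
        ((L : ℤ) + R + 1 ≤ n j ∧ n j ≤ 2 * L - R) := fun j h => by
      simpa only [I, Finset.mem_union, Finset.mem_Icc] using hj j h
    have hne : boxIndex L n ≠ boxIndex L (Bond.tgt (n, k)) := by
      intro h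
      have h := congrFun h k
      rw [boxIndex, boxIndex, show Bond.tgt (n, k) k = n k + 1 from tgt_apply_self _] at h
      simp [hk] at h
    refine ⟨boxIndex L n, boxIndex L (Bond.tgt (n, k)), hne, ?_, ?_, ?_⟩
    · apply mem_subBox_boxIndex
      rw [mem_bigBox]
      intro j
      by_cases h : j = k
      · subst h; omega
      · have := hI' j h; omega
    · apply mem_subBox_boxIndex
      rw [mem_bigBox]
      intro j
      by_cases h : j = k
      · subst h
        rw [show Bond.tgt (n, j) j = n j + 1 from tgt_apply_self _]
        omega
      · have := hI' j h
        rw [show Bond.tgt (n, k) j = n j from tgt_apply_of_ne _ h]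
        omega
    · intro m hm
      have hm' : ∀ j, |m j - n j| ≤ (R : ℤ) := hm
      have hmB : m ∈ bigBox d L := by
        rw [mem_bigBox]
        intro j
        have h1 := abs_le.1 (hm' j)
        by_cases h : j = k
        · subst h; omega
        · have := hI' j h; omega
      -- A move of at most `R` in a tangential direction cannot cross the middle, so only the index
      -- in direction `k` can change.
      have hoff : ∀ j, j ≠ k → boxIndex L m j = boxIndex L n j := fun j h => by
        have h1 := abs_le.1 (hm' j)
        have h2 := hI' j h
        unfold boxIndex
        refine if_congr ?_ rfl rfl
        omega
      have hmm := mem_subBox_boxIndex hmB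
      rw [Finset.mem_union]
      by_cases hmk : m k ≤ L
      · left
        rwa [show boxIndex L n = boxIndex L m from ?_]
        ext1 j
        by_cases h : j = k
        · subst h; simp [boxIndex, hk, hmk]
        · exact (hoff j h).symm
      · right
        rwa [show boxIndex L (Bond.tgt (n, k)) = boxIndex L m from ?_]
        ext1 j
        by_cases h : j = k
        · subst h
          rw [boxIndex, boxIndex, show Bond.tgt (n, j) j = n j + 1 from tgt_apply_self _,
            if_neg hmk, if_neg (by omega)]
        · rw [hoff j h, boxIndex, boxIndex, tgt_apply_of_ne _ h]
  refine ⟨A, fun b hb => (mem_corridor.1 (hfar b hb).mem_corridor).1, hfar, ?_⟩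
  rw [Finset.card_image_of_injective, Finset.card_sigma, Finset.sum_congr rfl
    (g := fun _ => (2 * (L - 2 * R)) ^ (d - 1)), Finset.sum_const, Finset.card_univ,
    Fintype.card_fin, smul_eq_mul]
  · intro k _
    rw [Fintype.card_piFinset, ← Finset.mul_prod_erase _ _ (Finset.mem_univ k),
      Finset.prod_congr rfl (g := fun _ => 2 * (L - 2 * R)), Finset.prod_const,
      Finset.card_erase_of_mem (Finset.mem_univ k)]
    · simp
    · intro j hj
      rw [if_neg (Finset.ne_of_mem_erase hj), hI]
  · rintro ⟨k, n⟩ ⟨k', n'⟩ h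
    obtain ⟨rfl, rfl⟩ := Prod.mk.inj h
    rfl

theorem corridor_subset (L : ℕ) : corridor d L ⊆ bonds (bigBox d L) := Finset.filter_subset _ _

theorem corridorSum_le (i : Fin d) {σ x t : ℝ} (hσ : 0 < σ) (hx : 0 ≤ x) (ht : t ≤ 1) (L : ℕ) :
    corridorSum d L σ x t ≤ (corridor d L).card * (1 + interfaceCorr i σ x t) := by
  classical
  calc corridorSum d L σ x t
      ≤ ∑ b : bonds (bigBox d L),
          if b.1 ∈ corridor d L then 1 + interfaceCorr i σ x t else 0 := by
        refine Finset.sum_le_sum fun b _ => ?_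
        split_ifs with h
        · exact add_le_add_right (nlBondCorr_le_interfaceCorr i hσ hx ht b h) 1
        · exact le_rfl
    _ = _ := by
        rw [Finset.sum_coe_sort (bonds (bigBox d L))
          (fun b => if b ∈ corridor d L then 1 + interfaceCorr i σ x t else 0),
          Finset.sum_ite_mem, Finset.inter_eq_right.2 (corridor_subset L), Finset.sum_const,
          nsmul_eq_mul]

/-- Far bonds contribute at least the centred-box value; on the others nonnegativity of the
correlation suffices. -/
theorem le_corridorSum (i : Fin d) {σ x t : ℝ} (hσ : 0 < σ) (hx : 0 ≤ x) (ht : t ≤ 1) {L R : ℕ}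
    (hL : R + 2 ≤ L) :
    (corridor d L).card + (d * (2 * (L - 2 * (R + 1))) ^ (d - 1) : ℕ) * planeCorr i σ x R t ≤
      corridorSum d L σ x t := by
  classical
  obtain ⟨A, hA, hfar, hcard⟩ := exists_farCorridorBond_card (d := d) (R := R + 1) hL
  calc ((corridor d L).card + (d * (2 * (L - 2 * (R + 1))) ^ (d - 1) : ℕ) * planeCorr i σ x R t : ℝ)
      = ∑ b : bonds (bigBox d L), ((if b.1 ∈ corridor d L then 1 else 0) +
          if b.1 ∈ A then planeCorr i σ x R t else 0) := by
        rw [Finset.sum_coe_sort (bonds (bigBox d L))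
          (fun b => (if b ∈ corridor d L then (1 : ℝ) else 0) +
            if b ∈ A then planeCorr i σ x R t else 0), Finset.sum_add_distrib,
          Finset.sum_ite_mem, Finset.sum_ite_mem, Finset.inter_eq_right.2 (corridor_subset L),
          Finset.inter_eq_right.2 hA, Finset.sum_const, Finset.sum_const, hcard]
        simp only [nsmul_eq_mul, mul_one]
    _ ≤ _ := by
        refine Finset.sum_le_sum fun b _ => ?_
        by_cases h2 : b.1 ∈ A
        · have hb := hfar _ h2
          rw [if_pos h2, if_pos hb.mem_corridor, if_pos hb.mem_corridor]
          exact add_le_add_right (planeCorr_le_nlBondCorr i hσ hx ht b hb) 1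
        · rw [if_neg h2, add_zero]
          split_ifs
          · exact le_add_of_nonneg_right (nlBondCorr_nonneg _ hσ _ _)
          · exact le_rfl

theorem card_corridor_div {L : ℕ} (hL : 1 ≤ L) :
    ((corridor d L).card : ℝ) / (L : ℝ) ^ (d - 1) = d * 2 ^ (d - 1) := by
  have : (L : ℝ) ^ (d - 1) ≠ 0 := pow_ne_zero _ (by positivity)
  rw [card_corridor hL, div_eq_iff this]
  push_cast
  rw [mul_pow]
  ring

theorem tendsto_card_far_div (d R : ℕ) :
    Tendsto (fun L : ℕ => ((d * (2 * (L - 2 * R)) ^ (d - 1) : ℕ) : ℝ) / (L : ℝ) ^ (d - 1)) atTop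
      (𝓝 (d * 2 ^ (d - 1))) := by
  have h1 : Tendsto (fun L : ℕ => (d : ℝ) * (2 * (1 - ((2 * R : ℕ) : ℝ) / (L : ℝ))) ^ (d - 1))
      atTop (𝓝 (d * (2 * (1 - 0)) ^ (d - 1))) :=
    (((tendsto_const_div_atTop_nhds_zero_nat _).const_sub 1).const_mul 2).pow (d - 1)
      |>.const_mul (d : ℝ)
  rw [sub_zero, mul_one] at h1
  refine h1.congr' ?_
  filter_upwards [eventually_ge_atTop (2 * R + 1)] with L hL
  have hL0 : (L : ℝ) ≠ 0 := by
    have : 0 < L := by omega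
    positivity
  have hcast : ((2 * (L - 2 * R) : ℕ) : ℝ) = 2 * ((L : ℝ) - (2 * R : ℕ)) := by
    rw [Nat.cast_mul, Nat.cast_sub (by omega), Nat.cast_ofNat]
  rw [Nat.cast_mul d, Nat.cast_pow, hcast, mul_div_assoc, ← div_pow]
  congr 2
  field_simp

theorem tendsto_corridorSum_div (i : Fin d) {σ x t : ℝ} (hσ : 0 < σ) (hx : 0 ≤ x) (ht : t ≤ 1) :
    Tendsto (fun L : ℕ => corridorSum d L σ x t / (L : ℝ) ^ (d - 1)) atTop
      (𝓝 (d * 2 ^ (d - 1) * (1 + interfaceCorr i σ x t))) := by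
  have hd : (0 : ℝ) < d * 2 ^ (d - 1) := by
    have : (0 : ℝ) < d := Nat.cast_pos.2 i.pos
    positivity
  refine tendsto_order.2 ⟨fun y hy => ?_, fun y hy => ?_⟩
  · have hy' : y / (d * 2 ^ (d - 1)) - 1 < interfaceCorr i σ x t := by
      rw [sub_lt_iff_lt_add', div_lt_iff₀' hd]
      exact hy
    -- The radius is fixed before `L` grows; the fraction of far bonds then tends to one.
    obtain ⟨R, hR⟩ := exists_lt_of_lt_ciSup hy'
    rw [sub_lt_iff_lt_add', div_lt_iff₀' hd] at hR
    have hlim := ((tendsto_card_far_div d (R + 1)).mul_const (planeCorr i σ x R t)).const_add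
      ((d : ℝ) * 2 ^ (d - 1))
    have hy2 : y < d * 2 ^ (d - 1) + d * 2 ^ (d - 1) * planeCorr i σ x R t := by linarith
    filter_upwards [hlim.eventually_const_lt hy2, eventually_ge_atTop (R + 2)] with L h1 h2
    refine h1.trans_le ?_
    rw [← card_corridor_div (d := d) (L := L) (by omega), div_mul_eq_mul_div, ← add_div]
    exact div_le_div_of_nonneg_right (le_corridorSum i hσ hx ht h2) (by positivity)
  · filter_upwards [eventually_ge_atTop 1] with L hL
    refine lt_of_le_of_lt ?_ hy
    rw [← card_corridor_div hL, div_mul_eq_mul_div]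
    exact div_le_div_of_nonneg_right (corridorSum_le i hσ hx ht L) (by positivity)

theorem interfaceCorr_le_one (i : Fin d) {σ x : ℝ} (hσ : 0 < σ) (t : ℝ) :
    interfaceCorr i σ x t ≤ 1 :=
  ciSup_le fun _ => nlBondCorr_le_one _ hσ _ _

theorem corridorSum_nonneg (L : ℕ) {σ : ℝ} (hσ : 0 < σ) (x t : ℝ) :
    0 ≤ corridorSum d L σ x t := by
  refine Finset.sum_nonneg fun b _ => ?_
  split_ifs
  · exact add_nonneg zero_le_one (nlBondCorr_nonneg _ hσ _ _)
  · exact le_rfl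

theorem tendsto_adjacencyPressure_div (i : Fin d) {β σ : ℝ} (hβ : 0 ≤ β) (hσ : 0 < σ) :
    Tendsto (fun L : ℕ => adjacencyPressure d β σ L / (L : ℝ) ^ (d - 1)) atTop
      (𝓝 ((d : ℝ) * (β * σ) ^ 2 * (2 : ℝ) ^ ((d : ℤ) - 2) *
        (1 + ∫ t in (0 : ℝ)..1, interfaceCorr i σ (β * σ) t))) := by
  set x := β * σ with hxdef
  have hx : 0 ≤ x := by positivity
  have hci : IntervalIntegrable (interfaceCorr i σ x) volume 0 1 :=
    (interfaceCorr_mono i hσ hx).intervalIntegrable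
  have hlim : Tendsto (fun L : ℕ => ∫ t in (0 : ℝ)..1, corridorSum d L σ x t / (L : ℝ) ^ (d - 1))
      atTop (𝓝 (∫ t in (0 : ℝ)..1, d * 2 ^ (d - 1) * (1 + interfaceCorr i σ x t))) := by
    refine intervalIntegral.tendsto_integral_filter_of_dominated_convergence
      (fun _ => d * 2 ^ (d - 1) * 2) ?_ ?_ intervalIntegrable_const ?_
    · exact Eventually.of_forall fun L =>
        ((corridorSum_mono L hσ hx).measurable.div_const _).aestronglyMeasurable
    · filter_upwards [eventually_ge_atTop 1] with L hL
      refine Eventually.of_forall fun t ht => ?_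
      rw [Set.uIoc_of_le zero_le_one] at ht
      rw [Real.norm_of_nonneg (div_nonneg (corridorSum_nonneg L hσ x t) (by positivity)),
        ← card_corridor_div hL, div_mul_eq_mul_div]
      refine div_le_div_of_nonneg_right ((corridorSum_le i hσ hx ht.2 L).trans ?_) (by positivity)
      refine mul_le_mul_of_nonneg_left ?_ (Nat.cast_nonneg _)
      linarith [interfaceCorr_le_one i (x := x) hσ t]
    · refine Eventually.of_forall fun t ht => ?_
      rw [Set.uIoc_of_le zero_le_one] at ht
      exact tendsto_corridorSum_div i hσ hx ht.2
  have hval : (d : ℝ) * x ^ 2 * (2 : ℝ) ^ ((d : ℤ) - 2) *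
      (1 + ∫ t in (0 : ℝ)..1, interfaceCorr i σ x t) =
      x ^ 2 / 2 * ∫ t in (0 : ℝ)..1, d * 2 ^ (d - 1) * (1 + interfaceCorr i σ x t) := by
    -- The exponent is an integer because `d = 1` gives `2⁻¹`.
    have hpow : (2 : ℝ) ^ ((d : ℤ) - 2) = 2 ^ (d - 1) / 2 := by
      have hd := i.pos
      rw [← zpow_natCast, div_eq_mul_inv, ← zpow_sub_one₀ two_ne_zero]
      congr 1
      omega
    rw [intervalIntegral.integral_const_mul, intervalIntegral.integral_add
      intervalIntegrable_const hci, hpow]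
    simp
    ring
  rw [hval]
  refine (hlim.const_mul (x ^ 2 / 2)).congr fun L => ?_
  rw [adjacencyPressure_eq_integral L hβ hσ, intervalIntegral.integral_const_mul,
    intervalIntegral.integral_div]
  ring

end Adjacency
end EA

theorem theorem1 (d : ℕ) (hd : 1 ≤ d) (β σ : ℝ) (hβ : 0 ≤ β) (hσ : 0 < σ) :
    ∃ c : ℝ → ℝ,
      (∀ t ∈ Set.Icc (0 : ℝ) 1, ∀ ε : ℝ, 0 < ε → ∃ R : ℕ, ∀ L : ℕ,
        ∀ b : EA.bonds (EA.bigBox d L), EA.FarCorridorBond L R b.1 →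
          |EA.nlBondCorr (EA.bigBox d L) (fun _ => σ) (EA.cutParam d L (β * σ) t) b - c t| < ε) ∧
      IntervalIntegrable c volume 0 1 ∧
      Tendsto (fun L : ℕ => EA.adjacencyPressure d β σ L / (L : ℝ) ^ (d - 1)) atTop
        (𝓝 ((d : ℝ) * (β * σ) ^ 2 * (2 : ℝ) ^ ((d : ℤ) - 2) * (1 + ∫ t in (0 : ℝ)..1, c t))) ∧
      (0 < β →
        0 < (d : ℝ) * (β * σ) ^ 2 * (2 : ℝ) ^ ((d : ℤ) - 2) * (1 + ∫ t in (0 : ℝ)..1, c t)) := by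
  have hx : 0 ≤ β * σ := by positivity
  -- The choice of direction is immaterial: the bounds compare with corridor bonds of every
  -- direction.
  let i : Fin d := ⟨0, hd⟩
  refine ⟨EA.interfaceCorr i σ (β * σ), fun t ht ε hε => ?_,
    (EA.interfaceCorr_mono i hσ hx).intervalIntegrable, EA.tendsto_adjacencyPressure_div i hβ hσ,
    fun hβ' => ?_⟩
  · obtain ⟨R, hR⟩ := exists_lt_of_lt_ciSup (sub_lt_self (EA.interfaceCorr i σ (β * σ) t) hε)
    -- `planeCorr` at index `R` lives in a box of radius `R + 1`, and the distance must match.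
    refine ⟨R + 1, fun L b hb => ?_⟩
    have h1 := EA.planeCorr_le_nlBondCorr i hσ hx ht.2 b hb
    have h2 := EA.nlBondCorr_le_interfaceCorr i hσ hx ht.2 b hb.mem_corridor
    rw [abs_lt]
    constructor <;> linarith
  · have hint : 0 ≤ ∫ t in (0 : ℝ)..1, EA.interfaceCorr i σ (β * σ) t :=
      intervalIntegral.integral_nonneg zero_le_one fun t _ => EA.interfaceCorr_nonneg i hσ t
    have hd' : (0 : ℝ) < d := Nat.cast_pos.2 hd
    positivity
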